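/- **Setting.** Fix countably infinite sets of numerals $\overline n$ ($n\in\mathbb Z$), symbolic constants, and (general) variables. *Precomputed terms* are numerals, symbolic constants, and the symbols $\mathit{inf}$, $\mathit{sup}$. Fix a total order on precomputed terms with least element $\mathit{inf}$ and greatest element $\mathit{sup}$, in which numerals are ordered in the standard way and contiguous. *Terms* are formed from precomputed terms and variables by the binary operations $+,-,\times,/,\backslash,..$. A ground term $t$ has a set $[t]$ of *values*: $[r]=\{r\}$ for precomputed $r$; for the operations $+,-,\times$, $[t_1\circ t_2]$ consists of the numerals $\overline{m\circ n}$ with $\overline m\in[t_1]$, $\overline n\in[t_2]$; $[t_1/t_2]$ and $[t_1\backslash t_2]$ consist, respectively, of the numerals of $\lfloor m/n\rfloor$ and of $m-n\lfloor m/n\rfloor$ with $\overline m\in[t_1]$, $\overline n\in[t_2]$, $n\ne0$; $[t_1..t_2]$ consists of the numerals $\overline k$ with $m\le k\le n$ for some $\overline m\in[t_1]$, $\overline n\in[t_2]$. For a tuple, $[t_1,\dots,t_n]=[t_1]\times\cdots\times[t_n]$. **Rules.** An *atom* is $p(\mathbf t)$, with $p$ a symbolic constant and $\mathbf t$ a tuple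 of terms; a *literal* is an atom possibly preceded by one or two occurrences of *not*; a *comparison* is $t_1\prec t_2$ with $\prec$ among $=,\ne,<,>,\le,\ge$. An *aggregate atom* is $count\{\mathbf X:\mathbf L\}\ge t$ or $count\{\mathbf X:\mathbf L\}\le t$, where $\mathbf X$ is a tuple of distinct variables, $\mathbf L$ is a conjunction of literals and comparisons in which every member of $\mathbf X$ occurs ($\mathbf X:\mathbf L$ is an *aggregate element*), and $t$ is a term not containing $..$. A *rule* is $H\leftarrow B_1\land\cdots\land B_n$, where each $B_i$ is a literal, a comparison or an aggregate atom, and $H$ is an atom $p(\mathbf t)$, an atom in braces $\{p(\mathbf t)\}$, or empty. A variable of a rule is *local* if all its occurrences are within aggregate elements, and *global* otherwise. A rule is *pure* if for every aggregate element $\mathbf X:\mathbf L$ in its body all members of $\mathbf X$ are local. **Infinitary logic.** *Infinitary formulas* over a set of atoms are built, with finite rank, from atoms by conjunctions and disjunctions of arbitrary sets of formulas and by implication; $\top$, $\bot$ are the empty conjunction and disjunction, and $\neg F$ is $F\to\bot$. $HT^\infty$ derives sequents $\Gamma\Rightarrow F$ ($\Gamma$ a finite set of formulas) from the axioms $F\Rightarrow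 F$, $\;F\lor(F\to G)\lor\neg G$, and $$\bigwedge_{\alpha\in A}\bigvee_{F\in\mathcal H_\alpha}F\;\to\;\bigvee_{(F_\alpha)\in\prod_\alpha\mathcal H_\alpha}\;\bigwedge_{\alpha\in A}F_\alpha\qquad(A\ne\emptyset)$$ by weakening and the natural-deduction introduction and elimination rules for infinitary $\bigwedge,\bigvee$ and for $\to$. $F$ and $G$ are *equivalent* in $HT^\infty$ extended by a set of axioms if $(F\to G)\land(G\to F)$ is derivable. **The propositional translation $\tau$.** A *precomputed atom* is $p(\mathbf r)$ with $\mathbf r$ a tuple of precomputed terms. For ground expressions, $\tau(p(\mathbf t))$, $\tau(\mathit{not}\ p(\mathbf t))$, $\tau(\mathit{not}\ \mathit{not}\ p(\mathbf t))$ are $\bigvee_{\mathbf r\in[\mathbf t]}p(\mathbf r)$, $\bigvee_{\mathbf r\in[\mathbf t]}\neg p(\mathbf r)$, $\bigvee_{\mathbf r\in[\mathbf t]}\neg\neg p(\mathbf r)$; $\tau(t_1\prec t_2)$ is $\top$ if $r_1\prec r_2$ for some $r_1\in[t_1]$, $r_2\in[t_2]$, and $\bot$ otherwise; $\tau$ commutes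 with finite conjunctions. If $[t]=\{c\}$, then $\tau(count\{\mathbf X:\mathbf L\}\ge t)$ and $\tau(count\{\mathbf X:\mathbf L\}\le t)$ are $$\bigvee_{\Delta:\overline{|\Delta|}\ge c}\;\bigwedge_{\mathbf x\in\Delta}\bigvee_{\mathbf w}\tau(\mathbf L^{\mathbf X,\mathbf W}_{\mathbf x,\mathbf w}),\qquad \bigwedge_{\Delta:\overline{|\Delta|}> c}\neg\bigwedge_{\mathbf x\in\Delta}\bigvee_{\mathbf w}\tau(\mathbf L^{\mathbf X,\mathbf W}_{\mathbf x,\mathbf w}),$$ where $\Delta$ ranges over finite sets of tuples of precomputed terms of the length of $\mathbf X$, $\mathbf W$ lists the variables of $\mathbf L$ not in $\mathbf X$, $\mathbf w$ ranges over tuples of precomputed terms of the length of $\mathbf W$, and $\mathbf L^{\mathbf X,\mathbf W}_{\mathbf x,\mathbf w}$ is the result of substituting $\mathbf x,\mathbf w$ for $\mathbf X,\mathbf W$; if $[t]=\emptyset$, both are $\bot$. For a rule without global variables with head $p(\mathbf t)$, $\{p(\mathbf t)\}$ or empty, and with body $B$, $\tau$ gives, respectively, $\tau(B)\to\bigwedge_{\mathbf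 r\in[\mathbf t]}p(\mathbf r)$, $\;\tau(B)\to\bigwedge_{\mathbf r\in[\mathbf t]}(p(\mathbf r)\lor\neg p(\mathbf r))$, $\;\neg\tau(B)$. For a pure rule $R$, $\tau(R)$ is the conjunction of $\tau(R')$ over all rules $R'$ obtained from $R$ by substituting precomputed terms for all global variables. **The first-order translation $\tau^*$.** The target language has general variables (ranging over precomputed terms) and integer variables (a subsort, ranging over numerals); precomputed terms as constants; $+,-,\times$ on integers; predicate constants $p/n$; and the comparison symbols (signature $\sigma_0$). For a term $t$, the formula $val_t(Z)$ expressing that $Z$ is a value of $t$ is defined recursively ($I,J,K,Q,S$ are fresh integer variables): $Z=t$ if $t$ is a precomputed term or variable; $\exists IJ(Z=I\circ J\land val_{t_1}(I)\land val_{t_2}(J))$ for $t_1\circ t_2$ with $\circ$ among $+,-,\times$; $\exists IJQS(D\land val_{t_1}(I)\land val_{t_2}(J)\land Z=Q)$ for $t_1/t_2$, and the same with $Z=S$ in place of $Z=Q$ for $t_1\backslash t_2$, where $D$ is $I=J\times Q+S\land J\ne\overline 0\land((\overline 0\le S\land S<J)\lor(J<S\land S\le\overline 0))$; $\exists IJK(val_{t_1}(I)\land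 val_{t_2}(J)\land I\le K\land K\le J\land Z=K)$ for $t_1..t_2$. For tuples, $val_{\mathbf t}(\mathbf Z)$ is the conjunction of the formulas $val_{t_i}(Z_i)$. Put $\tau^B(p(\mathbf t))=\exists\mathbf Z(val_{\mathbf t}(\mathbf Z)\land p(\mathbf Z))$, and similarly with $\neg p(\mathbf Z)$, $\neg\neg p(\mathbf Z)$ for literals with one or two *not*; $\tau^B(t_1\prec t_2)=\exists Z_1Z_2(val_{t_1}(Z_1)\land val_{t_2}(Z_2)\land Z_1\prec Z_2)$; $\tau^B$ commutes with conjunction. The signature $\sigma_1$ extends $\sigma_0$ by predicate constants $Atleast^{\mathbf X;\mathbf V}_F$ and $Atmost^{\mathbf X;\mathbf V}_F$, each with $|\mathbf V|+1$ general arguments, for all disjoint lists $\mathbf X,\mathbf V$ of distinct general variables and all formulas $F$ over $\sigma_0$ whose free variables belong to $\mathbf X$ or $\mathbf V$. For a precomputed term $r$, $\exists_{\ge r}\mathbf X F$ is $\exists\mathbf X_1\cdots\mathbf X_n(\bigwedge_iF^{\mathbf X}_{\mathbf X_i}\land\bigwedge_{i<j}\neg(\mathbf X_i=\mathbf X_j))$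 if $r=\overline n>\overline0$, $\top$ if $r\le\overline0$, and $\bot$ if $r$ exceeds all numerals; $\exists_{\le r}\mathbf XF$ is $\forall\mathbf X_1\cdots\mathbf X_{n+1}(\bigwedge_iF^{\mathbf X}_{\mathbf X_i}\to\bigvee_{i<j}\mathbf X_i=\mathbf X_j)$ if $r=\overline n\ge\overline 0$, $\bot$ if $r<\overline0$, and $\top$ if $r$ exceeds all numerals. *Defs* is the set of all sentences $\forall\mathbf V(Atleast^{\mathbf X;\mathbf V}_F(\mathbf V,r)\leftrightarrow\exists_{\ge r}\mathbf XF)$ and $\forall\mathbf V(Atmost^{\mathbf X;\mathbf V}_F(\mathbf V,r)\leftrightarrow\exists_{\le r}\mathbf XF)$. For a pure rule $R$ with body $B_1\land\cdots\land B_n$, let $B_i^*$ be $\tau^B(B_i)$ if $B_i$ is a literal or comparison, and $\exists C(val_t(C)\land Atleast^{\mathbf X;\mathbf V}_{\exists\mathbf W\tau^B(\mathbf L)}(\mathbf V,C))$ if $B_i$ is $count\{\mathbf X:\mathbf L\}\ge t$ (with $Atmost$ for $\le$), where $\mathbf V$ lists the global variables occurring in $\mathbf L$, $\mathbf W$ lists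 the local variables that occur in $\mathbf L$ but not in $\mathbf X$, and $C$ is fresh. Let $B^*=B^*_1\land\cdots\land B^*_n$, and let $\mathbf Z$ be a tuple of fresh general variables. Then $\tau^*(R)$ is the universal closure of $B^*\land val_{\mathbf t}(\mathbf Z)\to p(\mathbf Z)$ if the head is $p(\mathbf t)$, of $B^*\land val_{\mathbf t}(\mathbf Z)\to p(\mathbf Z)\lor\neg p(\mathbf Z)$ if the head is $\{p(\mathbf t)\}$, and of $\neg B^*$ if the head is empty. **Grounding.** For a sentence $F$ over $\sigma_1$, the infinitary formula $gr(F)$ over the atoms $p(\mathbf r)$, with $p$ any predicate constant of $\sigma_1$ other than the comparison symbols and $\mathbf r$ a tuple of precomputed terms, is defined as follows: $gr$ replaces comparisons by $\top$ or $\bot$ according to whether they hold for the values of their terms, replaces the arguments of other atomic formulas by their values, preserves $\bot$ and commutes with $\land,\lor,\to$; $gr(\forall X\,F)$ and $gr(\exists X\,F)$ are the conjunction and the disjunction of $gr(F^X_r)$ over all precomputed terms $r$ if $X$ is a general variable, and over all numerals $r$ if $X$ is an integer variable. For a set $\Gamma$ of sentences, $gr(\Gamma)=\{gr(F):F\in\Gamma\}$.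 **Theorem.** For every pure rule $R$, $gr(\tau^*(R))$ is equivalent to $\tau(R)$ in $HT^\infty$ extended by the set of axioms $gr(\mathit{Defs})$. -/

import Mathlib

namespace MGC

open scoped Classical

/-! ## Precomputed terms -/

/-- Variables of mini-gringo rules: a fixed countably infinite set. They are also the general
variables of the first-order target language. -/
abbrev Var := ℕ

/-- Integer variables of the target language. -/
abbrev IVar := ℕ

/-- Symbolic constants: a fixed countably infinite set. -/
abbrev SymConst := ℕ

/-- Precomputed terms: numerals, symbolic constants, and the symbols inf and sup. -/
inductive Precomputed where
  | num (n : ℤ)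
  | sym (c : SymConst)
  | inf
  | sup

/-- The conditions imposed on the selected total order on precomputed terms: inf is the least
element, sup is the greatest, numerals are ordered in the standard way and are contiguous. -/
structure AdmissibleOrder [LinearOrder Precomputed] : Prop where
  inf_le : ∀ r : Precomputed, Precomputed.inf ≤ r
  le_sup : ∀ r : Precomputed, r ≤ Precomputed.sup
  num_le_num : ∀ m n : ℤ, Precomputed.num m ≤ Precomputed.num n ↔ m ≤ n
  contiguous : ∀ (m n : ℤ) (r : Precomputed),
    Precomputed.num m ≤ r → r ≤ Precomputed.num n → ∃ k : ℤ, r = Precomputed.num k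

/-- The six comparison symbols. -/
inductive CmpOp where
  | eq | ne | lt | gt | le | ge

/-- The relation on precomputed terms that a comparison symbol stands for. -/
def CmpOp.Holds [LinearOrder Precomputed] : CmpOp → Precomputed → Precomputed → Prop
  | .eq, r, s => r = s
  | .ne, r, s => r ≠ s
  | .lt, r, s => r < s
  | .gt, r, s => r > s
  | .le, r, s => r ≤ s
  | .ge, r, s => r ≥ s

/-! ## Syntax of mini-gringo with counting -/

/-- The operation symbols `+`, `-`, `×`, `/`, `\` and `..`. -/
inductive BinOp where
  | add | sub | mul | div | mod | interval

inductive Term where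
  | pre (r : Precomputed)
  | var (x : Var)
  | bin (op : BinOp) (t₁ t₂ : Term)

/-- An atom `p(t₁, …, tₙ)`. -/
structure Atom where
  name : SymConst
  arity : ℕ
  args : Fin arity → Term

/-- The prefix of a literal: nothing, `not`, or `not not`. -/
inductive Sign where
  | pos | neg | negneg

/-- Literals and comparisons. -/
inductive BasicElem where
  | lit (s : Sign) (a : Atom)
  | cmp (op : CmpOp) (t₁ t₂ : Term)

/-- The relation symbols allowed in aggregate atoms. -/
inductive AggRel where
  | ge | le

/-- Members of rule bodies: literals, comparisons, and aggregate atoms `count{X : L} ≥ t`,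
`count{X : L} ≤ t`. -/
inductive BodyElem where
  | basic (b : BasicElem)
  | count (X : List Var) (L : List BasicElem) (rel : AggRel) (t : Term)

inductive Head where
  | basic (a : Atom)
  | choice (a : Atom)
  | constraint

/-- Expressions `Head ← Body`; see `Rule.WellFormed` for the syntactic conditions. -/
structure Rule where
  head : Head
  body : List BodyElem

def Term.vars : Term → Finset Var
  | .pre _ => ∅
  | .var x => {x}
  | .bin _ t₁ t₂ => t₁.vars ∪ t₂.vars

def Term.IntervalFree : Term → Prop
  | .pre _ => True
  | .var _ => True
  | .bin .interval _ _ => False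
  | .bin _ t₁ t₂ => t₁.IntervalFree ∧ t₂.IntervalFree

def Atom.vars (a : Atom) : Finset Var := Finset.univ.biUnion fun i => (a.args i).vars

def BasicElem.vars : BasicElem → Finset Var
  | .lit _ a => a.vars
  | .cmp _ t₁ t₂ => t₁.vars ∪ t₂.vars

/-- Variables occurring in a conjunction of literals and comparisons. -/
def basicVars : List BasicElem → Finset Var
  | [] => ∅
  | b :: L => b.vars ∪ basicVars L

/-- All variables occurring in a member of the body. -/
def BodyElem.vars : BodyElem → Finset Var
  | .basic b => b.vars
  | .count X L _ t => X.toFinset ∪ basicVars L ∪ t.vars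

/-- Variables with an occurrence outside the aggregate element. -/
def BodyElem.outerVars : BodyElem → Finset Var
  | .basic b => b.vars
  | .count _ _ _ t => t.vars

def Head.vars : Head → Finset Var
  | .basic a => a.vars
  | .choice a => a.vars
  | .constraint => ∅

/-- All variables of a rule. -/
def Rule.vars (R : Rule) : Finset Var :=
  R.head.vars ∪ R.body.foldr (fun B S => B.vars ∪ S) ∅

/-- Global variables: those with at least one occurrence outside all aggregate elements. The other
variables of the rule are local. -/
def Rule.globals (R : Rule) : Finset Var :=
  R.head.vars ∪ R.body.foldr (fun B S => B.outerVars ∪ S) ∅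

/-- In every aggregate atom `count{X : L} ≺ t`, the members of `X` are distinct and occur in `L`,
and `t` is interval-free. -/
def Rule.WellFormed (R : Rule) : Prop :=
  ∀ X L rel t, BodyElem.count X L rel t ∈ R.body →
    X.Nodup ∧ (∀ x ∈ X, x ∈ basicVars L) ∧ t.IntervalFree

/-- A rule is pure if, for every aggregate element `X : L` in its body, all members of `X`
are local. -/
def Rule.Pure (R : Rule) : Prop :=
  ∀ X L rel t, BodyElem.count X L rel t ∈ R.body → ∀ x ∈ X, x ∉ R.globals

/-! ## Substituting precomputed terms for variables in rules -/

/-- A partial assignment of precomputed terms to variables. -/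
abbrev Assignment := Var → Option Precomputed

/-- The assignment that maps the members of the list `xs` to the corresponding members of the
tuple `r`. -/
def assign (xs : List Var) (r : Fin xs.length → Precomputed) : Assignment := fun x =>
  if h : x ∈ xs then some (r ⟨xs.idxOf x, List.idxOf_lt_length_of_mem h⟩) else none

def Term.subst (σ : Assignment) : Term → Term
  | .pre r => .pre r
  | .var x => match σ x with
    | some r => .pre r
    | none => .var x
  | .bin op t₁ t₂ => .bin op (t₁.subst σ) (t₂.subst σ)

def Atom.subst (σ : Assignment) (a : Atom) : Atom :=
  ⟨a.name, a.arity, fun i => (a.args i).subst σ⟩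

def BasicElem.subst (σ : Assignment) : BasicElem → BasicElem
  | .lit s a => .lit s (a.subst σ)
  | .cmp op t₁ t₂ => .cmp op (t₁.subst σ) (t₂.subst σ)

/-- In an aggregate element `X : L` the tuple `X` is left alone: this is applied only to
assignments that are undefined on `X`. -/
def BodyElem.subst (σ : Assignment) : BodyElem → BodyElem
  | .basic b => .basic (b.subst σ)
  | .count X L rel t => .count X (L.map (BasicElem.subst σ)) rel (t.subst σ)

def Head.subst (σ : Assignment) : Head → Head
  | .basic a => .basic (a.subst σ)
  | .choice a => .choice (a.subst σ)
  | .constraint => .constraint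

def Rule.subst (σ : Assignment) (R : Rule) : Rule :=
  ⟨R.head.subst σ, R.body.map (BodyElem.subst σ)⟩

/-! ## Infinitary propositional formulas and the logic of here-and-there -/

/-- Infinitary formulas over the signature `A`; a conjunction or disjunction of a set of formulas
is given by a family enumerating the set. -/
inductive InfForm (A : Type) : Type 1 where
  | atom (a : A)
  | conj (ι : Type) (F : ι → InfForm A)
  | disj (ι : Type) (F : ι → InfForm A)
  | imp (F G : InfForm A)

namespace InfForm

variable {A B : Type}

def bot : InfForm A := disj Empty Empty.elim
def top : InfForm A := conj Empty Empty.elim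
def neg (F : InfForm A) : InfForm A := imp F bot
def and (F G : InfForm A) : InfForm A := conj Bool fun b => bif b then F else G
def or (F G : InfForm A) : InfForm A := disj Bool fun b => bif b then F else G
def iff (F G : InfForm A) : InfForm A := and (imp F G) (imp G F)

/-- The conjunction of the members of a list. -/
def conjList : List (InfForm A) → InfForm A
  | [] => top
  | F :: Fs => and F (conjList Fs)

/-- The formula obtained by viewing every atom as an atom of another signature. -/
def map (f : A → B) : InfForm A → InfForm B
  | atom a => atom (f a)
  | conj ι F => conj ι fun i => (F i).map f
  | disj ι F => disj ι fun i => (F i).map f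
  | imp F G => imp (F.map f) (G.map f)

/-- The nesting of connectives in the formula has depth at most `n`. -/
def DepthLE : InfForm A → ℕ → Prop
  | atom _, _ => True
  | conj _ F, n => ∃ m < n, ∀ i, (F i).DepthLE m
  | disj _ F, n => ∃ m < n, ∀ i, (F i).DepthLE m
  | imp F G, n => ∃ m < n, F.DepthLE m ∧ G.DepthLE m

/-- Infinitary propositional formulas have finite rank: conjunctions and disjunctions are formed
from sets of formulas of bounded rank. -/
def FiniteRank (F : InfForm A) : Prop := ∃ n, F.DepthLE n

end InfForm

/-- `HT T Γ F`: the sequent `Γ ⇒ F` is a theorem of the infinitary logic of here-and-there extended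
by the set `T` of axioms. The `FiniteRank` conditions say that sequents consist of infinitary
formulas. -/
inductive HT {A : Type} (T : Set (InfForm A)) : Finset (InfForm A) → InfForm A → Prop where
  | extra (F : InfForm A) : F ∈ T → F.FiniteRank → HT T ∅ F
  | ident (F : InfForm A) : F.FiniteRank → HT T {F} F
  | hosoi (F G : InfForm A) : F.FiniteRank → G.FiniteRank →
      HT T ∅ (.or F (.or (.imp F G) (.neg G)))
  | distr (I : Type) [Nonempty I] (H : I → Type) (F : ∀ i, H i → InfForm A) :
      (InfForm.conj I fun i => .disj (H i) (F i)).FiniteRank →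
      HT T ∅ (.imp (.conj I fun i => .disj (H i) (F i))
        (.disj (∀ i, H i) fun g => .conj I fun i => F i (g i)))
  | weak (Γ Δ : Finset (InfForm A)) (F : InfForm A) : (∀ G ∈ Δ, G.FiniteRank) →
      HT T Γ F → HT T (Γ ∪ Δ) F
  | conjI (Γ : Finset (InfForm A)) (ι : Type) (H : ι → InfForm A) :
      (∀ G ∈ Γ, G.FiniteRank) → (InfForm.conj ι H).FiniteRank →
      (∀ i, HT T Γ (H i)) → HT T Γ (.conj ι H)
  | conjE (Γ : Finset (InfForm A)) (ι : Type) (H : ι → InfForm A) (i : ι) :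
      HT T Γ (.conj ι H) → HT T Γ (H i)
  | disjI (Γ : Finset (InfForm A)) (ι : Type) (H : ι → InfForm A) (i : ι) :
      (InfForm.disj ι H).FiniteRank → HT T Γ (H i) → HT T Γ (.disj ι H)
  | disjE (Γ Δ : Finset (InfForm A)) (ι : Type) (H : ι → InfForm A) (F : InfForm A) :
      (∀ G ∈ Δ, G.FiniteRank) → F.FiniteRank →
      HT T Γ (.disj ι H) → (∀ i, HT T (insert (H i) Δ) F) → HT T (Γ ∪ Δ) F
  | impI (Γ : Finset (InfForm A)) (F G : InfForm A) :
      HT T (insert F Γ) G → HT T Γ (.imp F G)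
  | impE (Γ Δ : Finset (InfForm A)) (F G : InfForm A) :
      HT T Γ F → HT T Δ (.imp F G) → HT T (Γ ∪ Δ) G

/-- Formulas `F`, `G` are equivalent in the infinitary logic of here-and-there extended by
the axioms `T`. -/
def HTEquiv {A : Type} (T : Set (InfForm A)) (F G : InfForm A) : Prop := HT T ∅ (.iff F G)

/-! ## The first-order languages -/

/-- Terms of the sort integer. -/
inductive ITerm where
  | num (n : ℤ)
  | var (i : IVar)
  | add (s t : ITerm)
  | sub (s t : ITerm)
  | mul (s t : ITerm)

/-- Terms of the sort general; the sort integer is a subsort. -/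
inductive GTerm where
  | int (t : ITerm)
  | sym (c : SymConst)
  | inf
  | sup
  | var (x : Var)

/-- A precomputed term as an object constant; numerals have the sort integer. -/
def Precomputed.toGTerm : Precomputed → GTerm
  | .num n => .int (.num n)
  | .sym c => .sym c
  | .inf => .inf
  | .sup => .sup

/-- First-order formulas with general and integer variables over a signature whose predicate
constants, besides comparison symbols, are the elements `p` of `P`, of arity `ar p`. -/
inductive Fml (P : Type) (ar : P → ℕ) : Type where
  | falsum
  | cmp (op : CmpOp) (s t : GTerm)
  | pred (p : P) (args : Fin (ar p) → GTerm)
  | and (F G : Fml P ar)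
  | or (F G : Fml P ar)
  | imp (F G : Fml P ar)
  | allG (x : Var) (F : Fml P ar)
  | exG (x : Var) (F : Fml P ar)
  | allI (i : IVar) (F : Fml P ar)
  | exI (i : IVar) (F : Fml P ar)

def ITerm.vars : ITerm → Finset IVar
  | .num _ => ∅
  | .var i => {i}
  | .add s t => s.vars ∪ t.vars
  | .sub s t => s.vars ∪ t.vars
  | .mul s t => s.vars ∪ t.vars

/-- General variables of a term. -/
def GTerm.varsG : GTerm → Finset Var
  | .int _ => ∅
  | .sym _ => ∅
  | .inf => ∅
  | .sup => ∅
  | .var x => {x}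

/-- Integer variables of a term. -/
def GTerm.varsI : GTerm → Finset IVar
  | .int t => t.vars
  | .sym _ => ∅
  | .inf => ∅
  | .sup => ∅
  | .var _ => ∅

/-- Simultaneous substitution. -/
def ITerm.subst (τ : IVar → ITerm) : ITerm → ITerm
  | .num n => .num n
  | .var i => τ i
  | .add s t => .add (s.subst τ) (t.subst τ)
  | .sub s t => .sub (s.subst τ) (t.subst τ)
  | .mul s t => .mul (s.subst τ) (t.subst τ)

def GTerm.subst (σ : Var → GTerm) (τ : IVar → ITerm) : GTerm → GTerm
  | .int t => .int (t.subst τ)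
  | .sym c => .sym c
  | .inf => .inf
  | .sup => .sup
  | .var x => σ x

/-- The value of a term of the sort integer without variables (the value of a variable is
irrelevant). -/
def ITerm.value : ITerm → ℤ
  | .num n => n
  | .var _ => 0
  | .add s t => s.value + t.value
  | .sub s t => s.value - t.value
  | .mul s t => s.value * t.value

/-- The value of a term without variables (the value of a variable is irrelevant). -/
def GTerm.value : GTerm → Precomputed
  | .int t => .num t.value
  | .sym c => .sym c
  | .inf => .inf
  | .sup => .sup
  | .var _ => .inf

namespace Fml

variable {P : Type} {ar : P → ℕ}

def neg (F : Fml P ar) : Fml P ar := imp F falsum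
def top : Fml P ar := imp falsum falsum
def iff (F G : Fml P ar) : Fml P ar := and (imp F G) (imp G F)

def conjList : List (Fml P ar) → Fml P ar
  | [] => top
  | F :: Fs => and F (conjList Fs)

def disjList : List (Fml P ar) → Fml P ar
  | [] => falsum
  | F :: Fs => or F (disjList Fs)

def allList (xs : List Var) (F : Fml P ar) : Fml P ar := xs.foldr allG F
def exList (xs : List Var) (F : Fml P ar) : Fml P ar := xs.foldr exG F

/-- Free general variables. -/
def freeG : Fml P ar → Finset Var
  | falsum => ∅
  | cmp _ s t => s.varsG ∪ t.varsG
  | pred _ args => Finset.univ.biUnion fun i => (args i).varsG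
  | and F G => F.freeG ∪ G.freeG
  | or F G => F.freeG ∪ G.freeG
  | imp F G => F.freeG ∪ G.freeG
  | allG x F => F.freeG \ {x}
  | exG x F => F.freeG \ {x}
  | allI _ F => F.freeG
  | exI _ F => F.freeG

/-- Free integer variables. -/
def freeI : Fml P ar → Finset IVar
  | falsum => ∅
  | cmp _ s t => s.varsI ∪ t.varsI
  | pred _ args => Finset.univ.biUnion fun i => (args i).varsI
  | and F G => F.freeI ∪ G.freeI
  | or F G => F.freeI ∪ G.freeI
  | imp F G => F.freeI ∪ G.freeI
  | allG _ F => F.freeI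
  | exG _ F => F.freeI
  | allI i F => F.freeI \ {i}
  | exI i F => F.freeI \ {i}

/-- All general variables occurring in a formula, free or bound. -/
def occG : Fml P ar → Finset Var
  | falsum => ∅
  | cmp _ s t => s.varsG ∪ t.varsG
  | pred _ args => Finset.univ.biUnion fun i => (args i).varsG
  | and F G => F.occG ∪ G.occG
  | or F G => F.occG ∪ G.occG
  | imp F G => F.occG ∪ G.occG
  | allG x F => insert x F.occG
  | exG x F => insert x F.occG
  | allI _ F => F.occG
  | exI _ F => F.occG

/-- Simultaneous substitution for free variables, without renaming of bound variables: it is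
applied only when the terms being substituted contain no variables that are bound in the formula. -/
def subst : (Var → GTerm) → (IVar → ITerm) → Fml P ar → Fml P ar
  | _, _, falsum => falsum
  | σ, τ, cmp op s t => cmp op (s.subst σ τ) (t.subst σ τ)
  | σ, τ, pred p args => pred p fun i => (args i).subst σ τ
  | σ, τ, and F G => and (F.subst σ τ) (G.subst σ τ)
  | σ, τ, or F G => or (F.subst σ τ) (G.subst σ τ)
  | σ, τ, imp F G => imp (F.subst σ τ) (G.subst σ τ)
  | σ, τ, allG x F => allG x (F.subst (Function.update σ x (.var x)) τ)
  | σ, τ, exG x F => exG x (F.subst (Function.update σ x (.var x)) τ)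
  | σ, τ, allI i F => allI i (F.subst σ (Function.update τ i (.var i)))
  | σ, τ, exI i F => exI i (F.subst σ (Function.update τ i (.var i)))

/-- The result of substituting the precomputed term `r` for the general variable `x`. -/
def instG (x : Var) (r : Precomputed) (F : Fml P ar) : Fml P ar :=
  F.subst (Function.update .var x r.toGTerm) .var

/-- The result of substituting the numeral `n` for the integer variable `i`. -/
def instI (i : IVar) (n : ℤ) (F : Fml P ar) : Fml P ar :=
  F.subst .var (Function.update .var i (.num n))

/-- The depth of a formula. -/
def depth : Fml P ar → ℕ
  | falsum => 0
  | cmp _ _ _ => 0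
  | pred _ _ => 0
  | and F G => max F.depth G.depth + 1
  | or F G => max F.depth G.depth + 1
  | imp F G => max F.depth G.depth + 1
  | allG _ F => F.depth + 1
  | exG _ F => F.depth + 1
  | allI _ F => F.depth + 1
  | exI _ F => F.depth + 1

theorem depth_subst (F : Fml P ar) (σ : Var → GTerm) (τ : IVar → ITerm) :
    (F.subst σ τ).depth = F.depth := by
  induction F generalizing σ τ <;> simp_all [subst, depth]

end Fml

/-- Atoms `p(r)` such that the members of the tuple `r` are precomputed terms. -/
abbrev GAtom (P : Type) (ar : P → ℕ) : Type := Σ p : P, (Fin (ar p) → Precomputed)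

/-- The grounding operator on sentences. -/
noncomputable def gr [LinearOrder Precomputed] {P : Type} {ar : P → ℕ} :
    Fml P ar → InfForm (GAtom P ar)
  | .falsum => .bot
  | .cmp op s t => if op.Holds s.value t.value then .top else .bot
  | .pred p args => .atom ⟨p, fun i => (args i).value⟩
  | .and F G => .and (gr F) (gr G)
  | .or F G => .or (gr F) (gr G)
  | .imp F G => .imp (gr F) (gr G)
  | .allG x F => .conj Precomputed fun r => gr (F.instG x r)
  | .exG x F => .disj Precomputed fun r => gr (F.instG x r)
  | .allI i F => .conj ℤ fun n => gr (F.instI i n)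
  | .exI i F => .disj ℤ fun n => gr (F.instI i n)
termination_by F => F.depth
decreasing_by
  all_goals simp only [Fml.depth, Fml.instG, Fml.instI, Fml.depth_subst]
  all_goals omega

/-! ### The two signatures -/

/-- The predicate constants `p/n`. -/
structure Pred₀ where
  name : SymConst
  arity : ℕ

/-- Formulas over the signature whose predicate constants are the symbols `p/n` and the
comparison symbols. -/
abbrev Fml₀ : Type := Fml Pred₀ Pred₀.arity

/-- Precomputed atoms. -/
abbrev PreAtom : Type := GAtom Pred₀ Pred₀.arity

/-- The indices of the predicate constants `Atleast` and `Atmost`: disjoint lists `X`, `V` of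
distinct general variables, and a formula `F` whose free variables belong to `X` or to `V`. -/
structure CountIndex where
  X : List Var
  V : List Var
  F : Fml₀
  nodupX : X.Nodup
  nodupV : V.Nodup
  disj : List.Disjoint X V
  freeG : ∀ x ∈ F.freeG, x ∈ X ∨ x ∈ V
  freeI : F.freeI = ∅

/-- The predicate constants of the extended signature. -/
inductive Pred₁ where
  | base (p : Pred₀)
  | atleast (s : CountIndex)
  | atmost (s : CountIndex)

def Pred₁.arity : Pred₁ → ℕ
  | .base p => p.arity
  | .atleast s => s.V.length + 1
  | .atmost s => s.V.length + 1

/-- Formulas over the extended signature. -/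
abbrev Fml₁ : Type := Fml Pred₁ Pred₁.arity

/-- Extended precomputed atoms. -/
abbrev ExtAtom : Type := GAtom Pred₁ Pred₁.arity

/-- A precomputed atom as an extended precomputed atom. -/
def PreAtom.toExt (a : PreAtom) : ExtAtom := ⟨.base a.1, a.2⟩

/-- A formula over the smaller signature as a formula over the extended signature. -/
def Fml.lift : Fml₀ → Fml₁
  | .falsum => .falsum
  | .cmp op s t => .cmp op s t
  | .pred p args => .pred (.base p) args
  | .and F G => .and F.lift G.lift
  | .or F G => .or F.lift G.lift
  | .imp F G => .imp F.lift G.lift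
  | .allG x F => .allG x F.lift
  | .exG x F => .exG x F.lift
  | .allI i F => .allI i F.lift
  | .exI i F => .exI i F.lift

/-- `Atleast(V, c)`. -/
def Fml.atleast (s : CountIndex) (c : GTerm) : Fml₁ :=
  .pred (.atleast s) (Fin.snoc (α := fun _ => GTerm) (fun i => .var (s.V.get i)) c)

/-- `Atmost(V, c)`. -/
def Fml.atmost (s : CountIndex) (c : GTerm) : Fml₁ :=
  .pred (.atmost s) (Fin.snoc (α := fun _ => GTerm) (fun i => .var (s.V.get i)) c)

/-! ### The formulas expressing that `F` holds for at least, or at most, `r` values of `X` -/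

/-- The first of the variables greater than all elements of `S`. -/
def freshFrom (S : Finset Var) : Var := S.sup id + 1

/-- The member number `k` of the tuple `Xᵢ` of fresh variables. -/
def copyVar (X : List Var) (F : Fml₀) (i k : ℕ) : Var :=
  freshFrom (F.occG ∪ X.toFinset) + (i * X.length + k)

/-- The members of `X₀, …, Xₙ₋₁`. -/
def copyVars (X : List Var) (F : Fml₀) (n : ℕ) : List Var :=
  (List.range n).flatMap fun i => (List.range X.length).map fun k => copyVar X F i k

/-- The result of substituting `Xᵢ` for `X` in `F`. -/
def copyFml (X : List Var) (F : Fml₀) (i : ℕ) : Fml₀ :=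
  F.subst (fun x => if x ∈ X then .var (copyVar X F i (X.idxOf x)) else .var x) .var

/-- The formula `Xᵢ = Xⱼ`. -/
def copyEq (X : List Var) (F : Fml₀) (i j : ℕ) : Fml₀ :=
  .conjList ((List.range X.length).map fun k =>
    .cmp .eq (.var (copyVar X F i k)) (.var (copyVar X F j k)))

/-- The pairs of natural numbers `i < j < n`. -/
def pairsBelow (n : ℕ) : List (ℕ × ℕ) :=
  (List.range n).flatMap fun j => (List.range j).map fun i => (i, j)

/-- `∃ X₀ ⋯ Xₙ₋₁ (⋀ᵢ F(Xᵢ) ∧ ⋀_{i<j} ¬ (Xᵢ = Xⱼ))`. -/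
def atleastN (n : ℕ) (X : List Var) (F : Fml₀) : Fml₀ :=
  .exList (copyVars X F n)
    (.and (.conjList ((List.range n).map (copyFml X F)))
      (.conjList ((pairsBelow n).map fun p => .neg (copyEq X F p.1 p.2))))

/-- `∀ X₀ ⋯ Xₙ (⋀ᵢ F(Xᵢ) → ⋁_{i<j} Xᵢ = Xⱼ)`. -/
def atmostN (n : ℕ) (X : List Var) (F : Fml₀) : Fml₀ :=
  .allList (copyVars X F (n + 1))
    (.imp (.conjList ((List.range (n + 1)).map (copyFml X F)))
      (.disjList ((pairsBelow (n + 1)).map fun p => copyEq X F p.1 p.2)))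

/-- `∃_{≥ r} X F`. A precomputed term that is not a numeral and is not below `0` is greater than
all numerals. -/
noncomputable def existsGE [LinearOrder Precomputed] (r : Precomputed) (X : List Var) (F : Fml₀) :
    Fml₀ :=
  if r ≤ .num 0 then .top
  else match r with
    | .num n => atleastN n.toNat X F
    | _ => .falsum

/-- `∃_{≤ r} X F`. A precomputed term that is not a numeral and is not below `0` is greater than
all numerals. -/
noncomputable def existsLE [LinearOrder Precomputed] (r : Precomputed) (X : List Var) (F : Fml₀) :
    Fml₀ :=
  if r < .num 0 then .falsum
  else match r with
    | .num n => atmostN n.toNat X F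
    | _ => .top

/-- The definitions of the predicate constants `Atleast` and `Atmost`. -/
def Defs [LinearOrder Precomputed] : Set Fml₁ :=
  {S | ∃ (s : CountIndex) (r : Precomputed),
    S = .allList s.V (.iff (.atleast s r.toGTerm) (existsGE r s.X s.F).lift) ∨
    S = .allList s.V (.iff (.atmost s r.toGTerm) (existsLE r s.X s.F).lift)}

/-- The grounded definitions. -/
def grDefs [LinearOrder Precomputed] : Set (InfForm ExtAtom) := gr '' Defs

/-! ## The propositional translation -/

/-- The set of values of a ground term (a variable has no values). -/
def Term.values : Term → Set Precomputed
  | .pre r => {r}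
  | .var _ => ∅
  | .bin .add t₁ t₂ =>
      {r | ∃ m n : ℤ, .num m ∈ t₁.values ∧ .num n ∈ t₂.values ∧ r = .num (m + n)}
  | .bin .sub t₁ t₂ =>
      {r | ∃ m n : ℤ, .num m ∈ t₁.values ∧ .num n ∈ t₂.values ∧ r = .num (m - n)}
  | .bin .mul t₁ t₂ =>
      {r | ∃ m n : ℤ, .num m ∈ t₁.values ∧ .num n ∈ t₂.values ∧ r = .num (m * n)}
  | .bin .div t₁ t₂ =>
      {r | ∃ m n : ℤ, .num m ∈ t₁.values ∧ .num n ∈ t₂.values ∧ n ≠ 0 ∧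
        r = .num ⌊(m : ℚ) / n⌋}
  | .bin .mod t₁ t₂ =>
      {r | ∃ m n : ℤ, .num m ∈ t₁.values ∧ .num n ∈ t₂.values ∧ n ≠ 0 ∧
        r = .num (m - n * ⌊(m : ℚ) / n⌋)}
  | .bin .interval t₁ t₂ =>
      {r | ∃ m n k : ℤ, .num m ∈ t₁.values ∧ .num n ∈ t₂.values ∧ m ≤ k ∧ k ≤ n ∧ r = .num k}

/-- The tuples of values of the arguments of a ground atom. -/
abbrev Atom.Values (a : Atom) : Type :=
  {r : Fin a.arity → Precomputed // ∀ i, r i ∈ (a.args i).values}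

/-- The precomputed atom `p(r)`, where `p` is the symbol of `a`. -/
def Atom.inst (a : Atom) (r : Fin a.arity → Precomputed) : InfForm PreAtom :=
  .atom ⟨⟨a.name, a.arity⟩, r⟩

/-- The result of applying `τ` to a ground literal or comparison. -/
noncomputable def BasicElem.tau [LinearOrder Precomputed] : BasicElem → InfForm PreAtom
  | .lit .pos a => .disj a.Values fun r => a.inst r.1
  | .lit .neg a => .disj a.Values fun r => .neg (a.inst r.1)
  | .lit .negneg a => .disj a.Values fun r => .neg (.neg (a.inst r.1))
  | .cmp op t₁ t₂ =>
      if ∃ r₁ ∈ t₁.values, ∃ r₂ ∈ t₂.values, op.Holds r₁ r₂ then .top else .bot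

/-- The variables that occur in `L` but do not belong to `X`. -/
def otherVars (X : List Var) (L : List BasicElem) : List Var :=
  (basicVars L \ X.toFinset).sort (· ≤ ·)

/-- The conjunction over all `x` in `Δ` of the disjunction over all `w` of the formulas obtained by
applying `τ` to the result of substituting `x`, `w` for `X`, `W` in `L`. -/
noncomputable def tauDelta [LinearOrder Precomputed] (X : List Var) (L : List BasicElem)
    (Δ : Finset (Fin X.length → Precomputed)) : InfForm PreAtom :=
  .conj {x : Fin X.length → Precomputed // x ∈ Δ} fun x =>
    .disj (Fin (otherVars X L).length → Precomputed) fun w =>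
      .conjList (L.map fun b =>
        (b.subst fun y => (assign X x.1 y).or (assign (otherVars X L) w y)).tau)

/-- The result of applying `τ` to a member of the body of a closed rule. -/
noncomputable def BodyElem.tau [LinearOrder Precomputed] : BodyElem → InfForm PreAtom
  | .basic b => b.tau
  | .count X L .ge t =>
      if h : ∃ c, t.values = {c} then
        .disj {Δ : Finset (Fin X.length → Precomputed) // Precomputed.num Δ.card ≥ h.choose}
          fun Δ => tauDelta X L Δ.1
      else .bot
  | .count X L .le t =>
      if h : ∃ c, t.values = {c} then
        .conj {Δ : Finset (Fin X.length → Precomputed) // Precomputed.num Δ.card > h.choose}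
          fun Δ => .neg (tauDelta X L Δ.1)
      else .bot

/-- The result of applying `τ` to a closed rule. -/
noncomputable def Rule.tauClosed [LinearOrder Precomputed] (R : Rule) : InfForm PreAtom :=
  match R.head with
  | .basic a => .imp (.conjList (R.body.map BodyElem.tau)) (.conj a.Values fun r => a.inst r.1)
  | .choice a => .imp (.conjList (R.body.map BodyElem.tau))
      (.conj a.Values fun r => .or (a.inst r.1) (.neg (a.inst r.1)))
  | .constraint => .neg (.conjList (R.body.map BodyElem.tau))

/-- The list of global variables of a rule. -/
def Rule.globalList (R : Rule) : List Var := R.globals.sort (· ≤ ·)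

/-- The result of applying `τ` to a pure rule: the conjunction over all closed rules obtained by
substituting precomputed terms for the global variables. -/
noncomputable def Rule.tau [LinearOrder Precomputed] (R : Rule) : InfForm PreAtom :=
  .conj (Fin R.globalList.length → Precomputed) fun v =>
    (R.subst (assign R.globalList v)).tauClosed

/-! ## The first-order translation -/

section Translation

variable {P : Type} {ar : P → ℕ}

/-- `val t Z k` is the formula expressing that `Z` is a value of `t`; the bound integer variables
are chosen among those with numbers `k`, `k + 1`, …, so that `k` has to be greater than the numbers
of all integer variables in `Z`. -/
def val : Term → GTerm → ℕ → Fml P ar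
  | .pre r, Z, _ => .cmp .eq Z r.toGTerm
  | .var x, Z, _ => .cmp .eq Z (.var x)
  | .bin .add t₁ t₂, Z, k =>
      .exI k <| .exI (k + 1) <| .conjList
        [.cmp .eq Z (.int (.add (.var k) (.var (k + 1)))),
          val t₁ (.int (.var k)) (k + 2), val t₂ (.int (.var (k + 1))) (k + 2)]
  | .bin .sub t₁ t₂, Z, k =>
      .exI k <| .exI (k + 1) <| .conjList
        [.cmp .eq Z (.int (.sub (.var k) (.var (k + 1)))),
          val t₁ (.int (.var k)) (k + 2), val t₂ (.int (.var (k + 1))) (k + 2)]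
  | .bin .mul t₁ t₂, Z, k =>
      .exI k <| .exI (k + 1) <| .conjList
        [.cmp .eq Z (.int (.mul (.var k) (.var (k + 1)))),
          val t₁ (.int (.var k)) (k + 2), val t₂ (.int (.var (k + 1))) (k + 2)]
  | .bin .div t₁ t₂, Z, k =>
      .exI k <| .exI (k + 1) <| .exI (k + 2) <| .exI (k + 3) <| .conjList
        [divMod k, val t₁ (.int (.var k)) (k + 4), val t₂ (.int (.var (k + 1))) (k + 4),
          .cmp .eq Z (.int (.var (k + 2)))]
  | .bin .mod t₁ t₂, Z, k =>
      .exI k <| .exI (k + 1) <| .exI (k + 2) <| .exI (k + 3) <| .conjList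
        [divMod k, val t₁ (.int (.var k)) (k + 4), val t₂ (.int (.var (k + 1))) (k + 4),
          .cmp .eq Z (.int (.var (k + 3)))]
  | .bin .interval t₁ t₂, Z, k =>
      .exI k <| .exI (k + 1) <| .exI (k + 2) <| .conjList
        [val t₁ (.int (.var k)) (k + 3), val t₂ (.int (.var (k + 1))) (k + 3),
          .cmp .le (.int (.var k)) (.int (.var (k + 2))),
          .cmp .le (.int (.var (k + 2))) (.int (.var (k + 1))),
          .cmp .eq Z (.int (.var (k + 2)))]
where
  /-- With `I`, `J`, `Q`, `R` for the integer variables `k`, …, `k + 3`: `J ≠ 0`, and `Q`, `R` are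
  the quotient, rounded down, and the remainder in the division of `I` by `J`, that is,
  `I = J × Q + R ∧ J ≠ 0 ∧ ((0 ≤ R ∧ R < J) ∨ (J < R ∧ R ≤ 0))`. -/
  divMod (k : ℕ) : Fml P ar :=
    .conjList
      [.cmp .eq (.int (.var k)) (.int (.add (.mul (.var (k + 1)) (.var (k + 2))) (.var (k + 3)))),
        .cmp .ne (.int (.var (k + 1))) (.int (.num 0)),
        .or
          (.and (.cmp .le (.int (.num 0)) (.int (.var (k + 3))))
            (.cmp .lt (.int (.var (k + 3))) (.int (.var (k + 1)))))
          (.and (.cmp .lt (.int (.var (k + 1))) (.int (.var (k + 3))))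
            (.cmp .le (.int (.var (k + 3))) (.int (.num 0))))]

/-- `val` for the tuple of arguments of an atom and the tuple `Z` of general variables with the
numbers `z`, `z + 1`, …. -/
def valArgs (a : Atom) (z : Var) : Fml P ar :=
  .conjList (List.ofFn fun i : Fin a.arity => val (a.args i) (.var (z + i)) 0)

/-- The tuple of general variables with the numbers `z`, `z + 1`, …, `z + n - 1`. -/
def varTuple (z : Var) (n : ℕ) : List Var := (List.range n).map fun i => z + i

end Translation

/-- The atomic formula `p(Z)`, where `p` is the symbol of the atom `a`, and `Z` is the tuple of
general variables with the numbers `z`, `z + 1`, …. -/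
def predArgs (a : Atom) (z : Var) : Fml₀ :=
  .pred ⟨a.name, a.arity⟩ fun i => .var (z + i)

/-- The translation of literals and comparisons in rule bodies. -/
def BasicElem.tauB : BasicElem → Fml₀
  | .lit s a =>
      let z := freshFrom a.vars
      .exList (varTuple z a.arity) <| .and (valArgs a z) <| match s with
        | .pos => predArgs a z
        | .neg => .neg (predArgs a z)
        | .negneg => .neg (.neg (predArgs a z))
  | .cmp op t₁ t₂ =>
      let z := freshFrom (t₁.vars ∪ t₂.vars)
      .exG z <| .exG (z + 1) <|
        .and (val t₁ (.var z) 0) <| .and (val t₂ (.var (z + 1)) 0) <|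
          .cmp op (.var z) (.var (z + 1))

/-- The translation of a conjunction of literals and comparisons. -/
def tauBConj (L : List BasicElem) : Fml₀ := .conjList (L.map BasicElem.tauB)

namespace Fml

variable {P : Type} {ar : P → ℕ}

theorem varsG_int (t : ITerm) : (GTerm.int t).varsG = ∅ := rfl
theorem varsG_var (x : Var) : (GTerm.var x).varsG = {x} := rfl
theorem varsI_int (t : ITerm) : (GTerm.int t).varsI = t.vars := rfl
theorem varsI_var (x : Var) : (GTerm.var x).varsI = ∅ := rfl

theorem freeG_exList (xs : List Var) (F : Fml P ar) :
    (exList xs F).freeG = F.freeG \ xs.toFinset := by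
  induction xs with
  | nil => simp [exList]
  | cons x xs ih =>
    have h : exList (x :: xs) F = exG x (exList xs F) := rfl
    rw [h, freeG, ih]
    ext y
    simp only [Finset.mem_sdiff, Finset.mem_singleton, List.mem_toFinset, List.mem_cons]
    tauto

theorem freeI_exList (xs : List Var) (F : Fml P ar) : (exList xs F).freeI = F.freeI := by
  induction xs with
  | nil => rfl
  | cons x xs ih => exact ih

theorem mem_freeG_conjList {Fs : List (Fml P ar)} {x : Var} :
    x ∈ (conjList Fs).freeG ↔ ∃ F ∈ Fs, x ∈ F.freeG := by
  induction Fs with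
  | nil => simp [conjList, top, freeG]
  | cons F Fs ih => simp [conjList, freeG, ih]

theorem mem_freeI_conjList {Fs : List (Fml P ar)} {x : IVar} :
    x ∈ (conjList Fs).freeI ↔ ∃ F ∈ Fs, x ∈ F.freeI := by
  induction Fs with
  | nil => simp [conjList, top, freeI]
  | cons F Fs ih => simp [conjList, freeI, ih]

theorem freeG_val (t : Term) (Z : GTerm) (k : ℕ) {x : Var}
    (hx : x ∈ (val t Z k : Fml P ar).freeG) : x ∈ t.vars ∨ x ∈ Z.varsG := by
  induction t generalizing Z k with
  | pre r => cases r <;> simpa [val, freeG, Precomputed.toGTerm, GTerm.varsG, Term.vars] using hx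
  | var y =>
    simp only [val, freeG, varsG_var, Finset.mem_union] at hx
    simpa only [Term.vars, or_comm] using hx
  | bin op t₁ t₂ ih₁ ih₂ =>
    have e₁ : ∀ i m, x ∈ (val t₁ (.int (.var i)) m : Fml P ar).freeG → x ∈ t₁.vars := by
      intro i m h
      simpa [varsG_int, varsG_var] using ih₁ _ _ h
    have e₂ : ∀ i m, x ∈ (val t₂ (.int (.var i)) m : Fml P ar).freeG → x ∈ t₂.vars := by
      intro i m h
      simpa [varsG_int, varsG_var] using ih₂ _ _ h
    cases op <;>
      simp only [val, val.divMod, freeG, mem_freeG_conjList, List.mem_cons, List.not_mem_nil,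
        or_false, exists_eq_or_imp, exists_eq_left, varsG_int, Finset.mem_union,
        Finset.notMem_empty, false_or] at hx <;>
      simp only [Term.vars, Finset.mem_union]
    all_goals
      have h₁ := e₁ k
      have h₂ := e₂ (k + 1)
      grind

theorem freeI_val (t : Term) (Z : GTerm) (k : ℕ) {i : IVar}
    (hi : i ∈ (val t Z k : Fml P ar).freeI) : i ∈ Z.varsI := by
  induction t generalizing Z k with
  | pre r => cases r <;>
      simpa [val, freeI, Precomputed.toGTerm, GTerm.varsI, ITerm.vars] using hi
  | var y => simpa [val, freeI, varsI_int, varsI_var] using hi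
  | bin op t₁ t₂ ih₁ ih₂ =>
    have e₁ : ∀ j m, i ∈ (val t₁ (.int (.var j)) m : Fml P ar).freeI → i = j := by
      intro j m h
      simpa [varsI_int, varsI_var, ITerm.vars] using ih₁ _ _ h
    have e₂ : ∀ j m, i ∈ (val t₂ (.int (.var j)) m : Fml P ar).freeI → i = j := by
      intro j m h
      simpa [varsI_int, varsI_var, ITerm.vars] using ih₂ _ _ h
    cases op <;>
      simp only [val, val.divMod, freeI, mem_freeI_conjList, List.mem_cons, List.not_mem_nil,
        or_false, exists_eq_or_imp, exists_eq_left, varsI_int, ITerm.vars, Finset.mem_union,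
        Finset.mem_sdiff, Finset.mem_singleton, Finset.notMem_empty, false_or] at hi
    all_goals
      have h₁ := e₁ k
      have h₂ := e₂ (k + 1)
      grind

theorem freeG_valArgs (a : Atom) (z : Var) {x : Var}
    (hx : x ∈ (valArgs a z : Fml P ar).freeG) : x ∈ a.vars ∨ x ∈ varTuple z a.arity := by
  simp only [valArgs, mem_freeG_conjList, List.mem_ofFn] at hx
  obtain ⟨_, ⟨i, rfl⟩, hx⟩ := hx
  rcases freeG_val _ _ _ hx with h | h
  · exact Or.inl (Finset.mem_biUnion.2 ⟨i, Finset.mem_univ _, h⟩)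
  · refine Or.inr (List.mem_map.2 ⟨i, List.mem_range.2 i.2, ?_⟩)
    simpa [varsG_int, varsG_var, eq_comm] using h

theorem freeI_valArgs (a : Atom) (z : Var) : (valArgs a z : Fml P ar).freeI = ∅ := by
  ext i
  simp only [valArgs, mem_freeI_conjList, List.mem_ofFn, Finset.notMem_empty, iff_false]
  rintro ⟨_, ⟨j, rfl⟩, hi⟩
  simpa [varsI_int, varsI_var] using freeI_val _ _ _ hi

theorem freeG_tauB (b : BasicElem) {x : Var} (hx : x ∈ b.tauB.freeG) : x ∈ b.vars := by
  cases b with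
  | lit s a =>
    simp only [BasicElem.tauB, freeG_exList, Finset.mem_sdiff, List.mem_toFinset, freeG,
      Finset.mem_union] at hx
    obtain ⟨hx, hz⟩ := hx
    rcases hx with h | h
    · exact (freeG_valArgs a _ h).resolve_right hz
    · refine absurd ?_ hz
      have : x ∈ (predArgs a (freshFrom a.vars)).freeG := by
        cases s <;> simpa [neg, freeG] using h
      simp only [predArgs, freeG, Finset.mem_biUnion, varsG_var, Finset.mem_singleton] at this
      obtain ⟨i, -, rfl⟩ := this
      exact List.mem_map.2 ⟨i, List.mem_range.2 i.2, rfl⟩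
  | cmp op t₁ t₂ =>
    simp only [BasicElem.tauB, freeG, Finset.mem_sdiff, Finset.mem_union, varsG_var,
      Finset.mem_singleton] at hx
    obtain ⟨⟨hx, h1⟩, h0⟩ := hx
    simp only [BasicElem.vars, Finset.mem_union]
    rcases hx with h | h | h
    · have := freeG_val _ _ _ h
      simp only [varsG_var, Finset.mem_singleton] at this
      tauto
    · have := freeG_val _ _ _ h
      simp only [varsG_var, Finset.mem_singleton] at this
      tauto
    · tauto

theorem freeI_tauB (b : BasicElem) : b.tauB.freeI = ∅ := by
  cases b with
  | lit s a =>
    have h : (predArgs a (freshFrom a.vars)).freeI = ∅ := by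
      ext i
      simp [predArgs, freeI, varsI_var]
    simp only [BasicElem.tauB, freeI_exList, freeI, freeI_valArgs]
    cases s <;> simp [neg, freeI, h]
  | cmp op t₁ t₂ =>
    ext i
    simp only [BasicElem.tauB, freeI, varsI_var, Finset.mem_union, Finset.notMem_empty,
      or_false, iff_false]
    rintro (h | h) <;> simpa [varsI_int, varsI_var] using freeI_val _ _ _ h

theorem freeG_tauBConj (L : List BasicElem) {x : Var} (hx : x ∈ (tauBConj L).freeG) :
    x ∈ basicVars L := by
  induction L with
  | nil => simp [tauBConj, conjList, top, freeG] at hx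
  | cons b L ih =>
    simp only [tauBConj, List.map_cons, conjList, freeG, Finset.mem_union] at hx
    exact Finset.mem_union.2 (hx.imp (freeG_tauB b) ih)

theorem freeI_tauBConj (L : List BasicElem) : (tauBConj L).freeI = ∅ := by
  induction L with
  | nil => simp [tauBConj, conjList, top, freeI]
  | cons b L ih =>
    have : (conjList (L.map BasicElem.tauB)).freeI = ∅ := ih
    simp [tauBConj, conjList, freeI, freeI_tauB, this]

end Fml

/-- The condition on `X` in aggregate elements under which a member of the body can be translated;
`G` is the set of global variables of the rule. -/
def BodyElem.Translatable (G : Finset Var) : BodyElem → Prop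
  | .basic _ => True
  | .count X _ _ _ => X.Nodup ∧ ∀ x ∈ X, x ∉ G

/-- The index `X; V`, `∃ W τᴮ(L)` of the predicate constant used in the translation of
`count{X : L} ≺ t`: here `V` is the list of global variables occurring in `L`, and `W` is the list
of local variables that occur in `L` and are not included in `X`. -/
def countIndex (G : Finset Var) (X : List Var) (L : List BasicElem) (hX : X.Nodup)
    (hG : ∀ x ∈ X, x ∉ G) : CountIndex where
  X := X
  V := (basicVars L ∩ G).sort (· ≤ ·)
  F := .exList (((basicVars L \ G) \ X.toFinset).sort (· ≤ ·)) (tauBConj L)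
  nodupX := hX
  nodupV := Finset.sort_nodup _ _
  disj := by
    intro x hx hV
    simp only [Finset.mem_sort, Finset.mem_inter] at hV
    exact hG x hx hV.2
  freeG := by
    intro x hx
    rw [Fml.freeG_exList] at hx
    simp only [Finset.sort_toFinset, Finset.mem_sdiff, List.mem_toFinset] at hx
    have := Fml.freeG_tauBConj L hx.1
    simp only [Finset.mem_sort, Finset.mem_inter]
    tauto
  freeI := by rw [Fml.freeI_exList, Fml.freeI_tauBConj]

/-- The formula `B*` for a member `B` of the body of a rule with the set `G` of global variables. -/
def BodyElem.star (G : Finset Var) : (B : BodyElem) → B.Translatable G → Fml₁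
  | .basic b, _ => b.tauB.lift
  | .count X L rel t, h =>
      let C := freshFrom (basicVars L ∪ G ∪ t.vars)
      .exG C <| .and (val t (.var C) 0) <| match rel with
        | .ge => .atleast (countIndex G X L h.1 h.2) (.var C)
        | .le => .atmost (countIndex G X L h.1 h.2) (.var C)

theorem Rule.translatable {R : Rule} (hR : R.WellFormed) (hP : R.Pure) :
    ∀ B ∈ R.body, B.Translatable R.globals := by
  intro B hB
  cases B with
  | basic b => trivial
  | count X L rel t => exact ⟨(hR X L rel t hB).1, hP X L rel t hB⟩

/-- The first-order translation of a pure rule. The free variables of the formula to which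
universal closure is applied are the global variables and the members of the tuple `Z`. -/
def Rule.tauStar (R : Rule) (hR : R.WellFormed) (hP : R.Pure) : Fml₁ :=
  let body : Fml₁ :=
    .conjList (R.body.pmap (BodyElem.star R.globals) (Rule.translatable hR hP))
  let z := freshFrom R.vars
  match R.head with
  | .basic a =>
      .allList (R.globalList ++ varTuple z a.arity) <|
        .imp (.and body (valArgs a z)) (predArgs a z).lift
  | .choice a =>
      .allList (R.globalList ++ varTuple z a.arity) <|
        .imp (.and body (valArgs a z)) (.or (predArgs a z).lift (.neg (predArgs a z).lift))
  | .constraint => .allList R.globalList (.neg body)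

end MGC

/-!
The two translations are compared semantically, by means of a completeness theorem.

The infinitary logic of here-and-there is strongly complete with respect to Kripke models with two
worlds (`HT.complete`): a formula of finite rank that holds in every world in which all axioms hold
is derivable; the proof is in the style of Kalmár. The distributivity axiom, applied to instances of
Hosoi's axiom for atoms, provides a derivable disjunction each member of which decides, for all
atoms `a` and `b` simultaneously, between `¬a` and `¬¬a`, and among `a`, `a → b`, `¬b`. Such a
member describes a two-world model (`exists_describes`), and from this description every formula `F` of
finite rank is decided in the three-valued sense (`Describes.decides`): it is provable, or
refutable, or provably equivalent to a fixed formula `M`. An axiom that falls in the last case makes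
`M` provable, so that the two worlds of the model collapse. Axioms are used one at a time, and this
is why it does not matter that the ranks of the grounded definitions of `Atleast` and `Atmost` are
unbounded.

It remains to check that the two formulas hold in the same worlds of every model of the grounded
definitions (`sat_tauStar`). Grounding preserves satisfaction (`Fml.sat_gr`), so that the
first-order formulas can be evaluated under assignments of precomputed terms to variables, without
grounding them. The formula `val t Z` expresses then that the value of `Z` is among the values of
`t` (`sat_val`), independently of the world. Both counting formulas and the propositional
translations of aggregate atoms speak about finite sets of tuples: `n` pairwise distinct tuples
satisfying a condition exist iff some finite set of at least `n` tuples consists of such tuples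
(`sat_existsGE`, `sat_existsLE`). That a precomputed term which is neither a numeral nor below `0`
exceeds all numerals follows from contiguity.
-/

namespace MGC

open scoped Classical

/-! ### Here-and-there satisfaction of infinitary formulas -/

namespace InfForm

variable {A B : Type}

/-- Satisfaction of an infinitary formula at a world of the two-world Kripke model `I`: the world
`false` is "here", the world `true` is "there", and `I w` is the set of atoms true at `w`. The order
of `Bool` serves as the accessibility relation. -/
def Sat (I : Bool → A → Prop) : InfForm A → Bool → Prop
  | atom a, w => I w a
  | conj _ F, w => ∀ i, (F i).Sat I w
  | disj _ F, w => ∃ i, (F i).Sat I w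
  | imp F G, w => ∀ v, w ≤ v → F.Sat I v → G.Sat I v

theorem Sat.mono {I : Bool → A → Prop} (hI : ∀ a, I false a → I true a) {F : InfForm A}
    {w v : Bool} (hwv : w ≤ v) (h : F.Sat I w) : F.Sat I v := by
  induction F generalizing w v with
  | atom a =>
    cases w <;> cases v
    · exact h
    · exact hI a h
    · exact absurd hwv (by decide)
    · exact h
  | conj ι F ih => exact fun i => ih i hwv (h i)
  | disj ι F ih => exact h.imp fun i => ih i hwv
  | imp F G _ _ => exact fun u hu => h u (hwv.trans hu)

variable {I : Bool → A → Prop} {F G : InfForm A} {w : Bool}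

@[simp] theorem sat_top : (top : InfForm A).Sat I w := fun i => i.elim

@[simp] theorem not_sat_bot : ¬ (bot : InfForm A).Sat I w := fun ⟨i, _⟩ => i.elim

@[simp] theorem sat_and : (and F G).Sat I w ↔ F.Sat I w ∧ G.Sat I w := by
  simp [and, Sat, and_comm]

@[simp] theorem sat_or : (or F G).Sat I w ↔ F.Sat I w ∨ G.Sat I w := by
  simp [or, Sat, or_comm]

@[simp] theorem sat_neg : (neg F).Sat I w ↔ ∀ v, w ≤ v → ¬ F.Sat I v := by
  simp [neg, Sat]

theorem sat_iff : (iff F G).Sat I w ↔ ∀ v, w ≤ v → (F.Sat I v ↔ G.Sat I v) := by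
  simp only [iff, sat_and, Sat]
  exact ⟨fun h v hv => ⟨h.1 v hv, h.2 v hv⟩,
    fun h => ⟨fun v hv => (h v hv).1, fun v hv => (h v hv).2⟩⟩

theorem sat_conjList {Fs : List (InfForm A)} :
    (conjList Fs).Sat I w ↔ ∀ F ∈ Fs, F.Sat I w := by
  induction Fs with
  | nil => simp [conjList]
  | cons F Fs ih => simp [conjList, ih]

theorem sat_map {I : Bool → B → Prop} {f : A → B} {F : InfForm A} {w : Bool} :
    (F.map f).Sat I w ↔ F.Sat (fun w a => I w (f a)) w := by
  induction F generalizing w with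
  | atom a => rfl
  | conj ι F ih => exact forall_congr' fun i => ih i
  | disj ι F ih => exact exists_congr fun i => ih i
  | imp F G ihF ihG =>
    exact forall_congr' fun v => imp_congr_right fun _ => imp_congr ihF ihG

/-! ### Finite rank -/

theorem DepthLE.mono {F : InfForm A} {m n : ℕ} (h : F.DepthLE m) (hmn : m ≤ n) :
    F.DepthLE n := by
  cases F with
  | atom a => trivial
  | conj ι F => exact h.imp fun k hk => ⟨hk.1.trans_le hmn, hk.2⟩
  | disj ι F => exact h.imp fun k hk => ⟨hk.1.trans_le hmn, hk.2⟩
  | imp F G => exact h.imp fun k hk => ⟨hk.1.trans_le hmn, hk.2⟩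

theorem finiteRank_atom (a : A) : (atom a).FiniteRank := ⟨0, trivial⟩

theorem finiteRank_conj_iff {ι : Type} {F : ι → InfForm A} :
    (conj ι F).FiniteRank ↔ ∃ n, ∀ i, (F i).DepthLE n :=
  ⟨fun ⟨_, m, _, h⟩ => ⟨m, h⟩, fun ⟨n, h⟩ => ⟨n + 1, n, n.lt_succ_self, h⟩⟩

theorem finiteRank_disj_iff {ι : Type} {F : ι → InfForm A} :
    (disj ι F).FiniteRank ↔ ∃ n, ∀ i, (F i).DepthLE n :=
  ⟨fun ⟨_, m, _, h⟩ => ⟨m, h⟩, fun ⟨n, h⟩ => ⟨n + 1, n, n.lt_succ_self, h⟩⟩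

theorem finiteRank_imp_iff : (imp F G).FiniteRank ↔ F.FiniteRank ∧ G.FiniteRank :=
  ⟨fun ⟨_, m, _, hF, hG⟩ => ⟨⟨m, hF⟩, ⟨m, hG⟩⟩, fun ⟨⟨m, hF⟩, ⟨n, hG⟩⟩ =>
    ⟨max m n + 1, max m n, Nat.lt_succ_self _, hF.mono (le_max_left _ _),
      hG.mono (le_max_right _ _)⟩⟩

theorem finiteRank_top : (top : InfForm A).FiniteRank :=
  finiteRank_conj_iff.2 ⟨0, fun i => i.elim⟩

theorem finiteRank_bot : (bot : InfForm A).FiniteRank :=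
  finiteRank_disj_iff.2 ⟨0, fun i => i.elim⟩

theorem FiniteRank.neg (hF : F.FiniteRank) : F.neg.FiniteRank :=
  finiteRank_imp_iff.2 ⟨hF, finiteRank_bot⟩

theorem FiniteRank.and (hF : F.FiniteRank) (hG : G.FiniteRank) : (F.and G).FiniteRank := by
  obtain ⟨⟨m, hF⟩, ⟨n, hG⟩⟩ := hF, hG
  refine finiteRank_conj_iff.2 ⟨max m n, ?_⟩
  rintro (_ | _)
  · exact hG.mono (le_max_right _ _)
  · exact hF.mono (le_max_left _ _)

theorem FiniteRank.or (hF : F.FiniteRank) (hG : G.FiniteRank) : (F.or G).FiniteRank := by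
  obtain ⟨⟨m, hF⟩, ⟨n, hG⟩⟩ := hF, hG
  refine finiteRank_disj_iff.2 ⟨max m n, ?_⟩
  rintro (_ | _)
  · exact hG.mono (le_max_right _ _)
  · exact hF.mono (le_max_left _ _)

theorem FiniteRank.of_conj {ι : Type} {F : ι → InfForm A} (h : (conj ι F).FiniteRank) (i : ι) :
    (F i).FiniteRank :=
  (finiteRank_conj_iff.1 h).imp fun _ h => h i

theorem FiniteRank.of_disj {ι : Type} {F : ι → InfForm A} (h : (disj ι F).FiniteRank) (i : ι) :
    (F i).FiniteRank :=
  (finiteRank_disj_iff.1 h).imp fun _ h => h i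

end InfForm

/-! ### Derived rules of the deductive system -/

open InfForm

variable {A : Type}

/-- All members of a context have finite rank. -/
def CtxFiniteRank (Γ : Finset (InfForm A)) : Prop := ∀ G ∈ Γ, G.FiniteRank

namespace HT

variable {T : Set (InfForm A)} {Γ Δ : Finset (InfForm A)} {F G : InfForm A}

theorem mono (hΔ : CtxFiniteRank Δ) (h : Γ ⊆ Δ) (d : HT T Γ F) : HT T Δ F := by
  have := HT.weak Γ Δ F hΔ d
  rwa [Finset.union_eq_right.2 h] at this

theorem mp (d : HT T Γ (.imp F G)) (e : HT T Γ F) : HT T Γ G := by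
  simpa using HT.impE Γ Γ F G e d

theorem hyp (hΓ : CtxFiniteRank Γ) (h : F ∈ Γ) : HT T Γ F :=
  (HT.ident F (hΓ F h)).mono hΓ (by simpa using h)

theorem imp_intro (hΓ : CtxFiniteRank Γ) (hF : F.FiniteRank)
    (h : ∀ Δ, Γ ⊆ Δ → CtxFiniteRank Δ → HT T Δ F → HT T Δ G) : HT T Γ (.imp F G) := by
  have hΔ : CtxFiniteRank (insert F Γ) := fun G hG => by
    rcases Finset.mem_insert.1 hG with rfl | hG
    exacts [hF, hΓ G hG]
  exact HT.impI _ _ _ (h _ (Finset.subset_insert _ _) hΔ (hyp hΔ (Finset.mem_insert_self _ _)))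

theorem disj_elim {ι : Type} {H : ι → InfForm A} (hΓ : CtxFiniteRank Γ)
    (hH : (disj ι H).FiniteRank) (hG : G.FiniteRank) (d : HT T Γ (.disj ι H))
    (h : ∀ i Δ, Γ ⊆ Δ → CtxFiniteRank Δ → HT T Δ (H i) → HT T Δ G) : HT T Γ G := by
  have := HT.disjE Γ Γ ι H G hΓ hG d fun i => by
    have hΔ : CtxFiniteRank (insert (H i) Γ) := fun G hG => by
      rcases Finset.mem_insert.1 hG with rfl | hG
      exacts [hH.of_disj i, hΓ G hG]
    exact h i _ (Finset.subset_insert _ _) hΔ (hyp hΔ (Finset.mem_insert_self _ _))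
  simpa using this

theorem ex_falso (hΓ : CtxFiniteRank Γ) (hF : F.FiniteRank) (d : HT T Γ .bot) : HT T Γ F :=
  disj_elim hΓ finiteRank_bot hF d fun i => i.elim

theorem imp_of (hΓ : CtxFiniteRank Γ) (hF : F.FiniteRank) (d : HT T Γ G) : HT T Γ (.imp F G) :=
  imp_intro hΓ hF fun _ h hΔ _ => d.mono hΔ h

theorem imp_of_neg (hΓ : CtxFiniteRank Γ) (hF : F.FiniteRank) (hG : G.FiniteRank)
    (d : HT T Γ (.neg F)) : HT T Γ (.imp F G) :=
  imp_intro hΓ hF fun _ h hΔ e => ex_falso hΔ hG ((mono hΔ h d : HT T _ (.imp F .bot)).mp e)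

theorem imp_trans (hΓ : CtxFiniteRank Γ) (hF : F.FiniteRank) {H : InfForm A}
    (d : HT T Γ (.imp F G)) (e : HT T Γ (.imp G H)) : HT T Γ (.imp F H) :=
  imp_intro hΓ hF fun _ h hΔ f => (e.mono hΔ h).mp ((d.mono hΔ h).mp f)

theorem top_intro (hΓ : CtxFiniteRank Γ) : HT T Γ .top :=
  HT.conjI _ _ _ hΓ finiteRank_top fun i => i.elim

end HT

/-- The members of Hosoi's disjunction `F ∨ (F → G) ∨ ¬G`. -/
def hosoiMember (F G : InfForm A) : Fin 3 → InfForm A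
  | 0 => F
  | 1 => .imp F G
  | 2 => .neg G

theorem ctxFiniteRank_empty : CtxFiniteRank (∅ : Finset (InfForm A)) := by
  simp [CtxFiniteRank]

theorem finiteRank_hosoiMember {F G : InfForm A} (hF : F.FiniteRank) (hG : G.FiniteRank) :
    (InfForm.disj (Fin 3) (hosoiMember F G)).FiniteRank := by
  obtain ⟨k, hk⟩ := hF
  obtain ⟨l, hl⟩ := finiteRank_imp_iff.2 ⟨⟨k, hk⟩, hG⟩
  obtain ⟨m, hm⟩ := hG.neg
  refine finiteRank_disj_iff.2 ⟨max k (max l m), fun i => ?_⟩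
  match i with
  | 0 => exact hk.mono (by simp)
  | 1 => exact hl.mono (by simp)
  | 2 => exact hm.mono (by simp)

theorem HT.hosoi_flat {T : Set (InfForm A)} {F G : InfForm A} (hF : F.FiniteRank)
    (hG : G.FiniteRank) : HT T ∅ (.disj (Fin 3) (hosoiMember F G)) := by
  have hFG := finiteRank_imp_iff.2 ⟨hF, hG⟩
  have hd := finiteRank_hosoiMember hF hG
  have h2 : (InfForm.or (.imp F G) (.neg G)).FiniteRank := hFG.or hG.neg
  refine HT.disj_elim ctxFiniteRank_empty (hF.or h2) hd (HT.hosoi F G hF hG) ?_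
  rintro (_ | _) Δ - hΔ d
  · refine HT.disj_elim hΔ h2 hd d ?_
    rintro (_ | _) Δ' - hΔ' d'
    · exact HT.disjI _ _ _ 2 hd d'
    · exact HT.disjI _ _ _ 1 hd d'
  · exact HT.disjI _ _ _ 0 hd d

/-! ### Strong completeness of the infinitary logic of here-and-there -/

/-- The context `Γ` describes the interpretation `I`, with `M` as the truth value in the middle:
atoms true here are provable, atoms false there are refutable, and all other atoms are provably
equivalent to `M`, whose negation is refutable. When `I` is total, that is, when the two worlds
coincide, `M` plays no role and can be `⊤`. -/
structure Describes (T : Set (InfForm A)) (Γ : Finset (InfForm A)) (I : Bool → A → Prop)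
    (M : InfForm A) : Prop where
  finiteRank : CtxFiniteRank Γ
  finiteRank_mid : M.FiniteRank
  mono : ∀ a, I false a → I true a
  neg_neg_mid : HT T Γ (.neg (.neg M))
  here : ∀ a, I false a → HT T Γ (.atom a)
  not_there : ∀ a, ¬ I true a → HT T Γ (.neg (.atom a))
  mid : ∀ a, I true a → ¬ I false a → HT T Γ (.imp (.atom a) M) ∧ HT T Γ (.imp M (.atom a))

/-- If a context describes an interpretation then it decides, in the three-valued sense, every
formula of finite rank. -/
theorem Describes.decides {T : Set (InfForm A)} {Γ : Finset (InfForm A)} {I : Bool → A → Prop}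
    {M : InfForm A} (h : Describes T Γ I M) (F : InfForm A) (hF : F.FiniteRank) :
    (F.Sat I false → HT T Γ F) ∧ (¬ F.Sat I true → HT T Γ (.neg F)) ∧
      (F.Sat I true → ¬ F.Sat I false → HT T Γ (.imp F M) ∧ HT T Γ (.imp M F)) := by
  have hΓ := h.finiteRank
  have hM := h.finiteRank_mid
  induction F with
  | atom a => exact ⟨h.here a, h.not_there a, h.mid a⟩
  | conj ι F ih =>
    have ih := fun i => ih i (hF.of_conj i)
    refine ⟨fun hs => HT.conjI _ _ _ hΓ hF fun i => (ih i).1 (hs i), fun hs => ?_,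
      fun ht hs => ⟨?_, ?_⟩⟩
    · obtain ⟨i, hi⟩ := not_forall.1 hs
      exact HT.imp_intro hΓ hF fun Δ hΔ hfr d =>
        (((ih i).2.1 hi).mono hfr hΔ : HT T Δ (.imp _ _)).mp (HT.conjE _ _ _ i d)
    · obtain ⟨i, hi⟩ := not_forall.1 hs
      exact HT.imp_intro hΓ hF fun Δ hΔ hfr d =>
        (((ih i).2.2 (ht i) hi).1.mono hfr hΔ).mp (HT.conjE _ _ _ i d)
    · refine HT.imp_intro hΓ hM fun Δ hΔ hfr d => HT.conjI _ _ _ hfr hF fun i => ?_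
      by_cases hi : (F i).Sat I false
      · exact ((ih i).1 hi).mono hfr hΔ
      · exact (((ih i).2.2 (ht i) hi).2.mono hfr hΔ).mp d
  | disj ι F ih =>
    have ih := fun i => ih i (hF.of_disj i)
    refine ⟨fun ⟨i, hi⟩ => HT.disjI _ _ _ i hF ((ih i).1 hi), fun hs => ?_,
      fun ⟨i, ht⟩ hs => ⟨?_, ?_⟩⟩
    · refine HT.imp_intro hΓ hF fun Δ hΔ hfr d =>
        HT.disj_elim hfr hF finiteRank_bot d fun i Δ' hΔ' hfr' d' => ?_
      exact (((ih i).2.1 fun hi => hs ⟨i, hi⟩).mono hfr' (hΔ.trans hΔ') : HT T Δ' (.imp _ _)).mp d'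
    · refine HT.imp_intro hΓ hF fun Δ hΔ hfr d =>
        HT.disj_elim hfr hF hM d fun i Δ' hΔ' hfr' d' => ?_
      by_cases hi : (F i).Sat I true
      · exact (((ih i).2.2 hi fun hi => hs ⟨i, hi⟩).1.mono hfr' (hΔ.trans hΔ')).mp d'
      · exact ((HT.imp_of_neg hΓ (hF.of_disj i) hM ((ih i).2.1 hi)).mono hfr' (hΔ.trans hΔ')).mp d'
    · exact HT.imp_intro hΓ hM fun Δ hΔ hfr d => HT.disjI _ _ _ i hF
        ((((ih i).2.2 ht fun hi => hs ⟨i, hi⟩).2.mono hfr hΔ).mp d)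
  | imp F G ihF ihG =>
    obtain ⟨frF, frG⟩ := finiteRank_imp_iff.1 hF
    obtain ⟨F1, F2, F3⟩ := ihF frF
    obtain ⟨G1, G2, G3⟩ := ihG frG
    refine ⟨fun hs => ?_, fun hs => ?_, fun ht hs => ?_⟩
    · by_cases hFt : F.Sat I true
      · by_cases hGh : G.Sat I false
        · exact HT.imp_of hΓ frF (G1 hGh)
        · have hFh : ¬ F.Sat I false := fun hFh => hGh (hs false le_rfl hFh)
          exact HT.imp_trans hΓ frF (F3 hFt hFh).1 (G3 (hs true (by decide) hFt) hGh).2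
      · exact HT.imp_of_neg hΓ frF frG (F2 hFt)
    · have hFG : F.Sat I true ∧ ¬ G.Sat I true := by
        simp only [Sat, not_forall] at hs
        obtain ⟨v, hv, h1, h2⟩ := hs
        cases v
        · exact absurd hv (by decide)
        · exact ⟨h1, h2⟩
      refine HT.imp_intro hΓ hF fun Δ hΔ hfr d => ?_
      have hFnot : HT T Δ (.imp F .bot) :=
        HT.imp_trans hfr frF d ((G2 hFG.2).mono hfr hΔ)
      by_cases hFh : F.Sat I false
      · exact hFnot.mp ((F1 hFh).mono hfr hΔ)
      · exact (h.neg_neg_mid.mono hfr hΔ : HT T Δ (.imp _ _)).mp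
          (HT.imp_trans hfr hM ((F3 hFG.1 hFh).2.mono hfr hΔ) hFnot)
    · have hFG : F.Sat I false ∧ ¬ G.Sat I false := by
        simp only [Sat, not_forall] at hs
        obtain ⟨v, hv, h1, h2⟩ := hs
        cases v
        · exact ⟨h1, h2⟩
        · exact absurd (ht true le_rfl h1) h2
      have hGt : G.Sat I true := ht true le_rfl (hFG.1.mono h.mono (by decide))
      obtain ⟨GM, MG⟩ := G3 hGt hFG.2
      exact ⟨HT.imp_intro hΓ hF fun Δ hΔ hfr d =>
          (GM.mono hfr hΔ).mp (d.mp ((F1 hFG.1).mono hfr hΔ)),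
        HT.imp_intro hΓ hM fun Δ hΔ hfr d => HT.imp_of hfr frF ((MG.mono hfr hΔ).mp d)⟩

/-- The instances of Hosoi's axiom used in the completeness proof: for an atom `a`, the instance
`¬a ∨ (¬a → a) ∨ ¬a`, which amounts to the weak law of the excluded middle for `a`; for atoms
`a`, `b`, the instance `a ∨ (a → b) ∨ ¬b`. -/
def diagramMember : A × Option A → Fin 3 → InfForm A
  | (a, none) => hosoiMember (.neg (.atom a)) (.atom a)
  | (a, some b) => hosoiMember (.atom a) (.atom b)

theorem depthLE_diagramMember (p : A × Option A) (i : Fin 3) :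
    (diagramMember p i).DepthLE 3 := by
  have h (a : A) : (InfForm.neg (.atom a)).DepthLE 2 :=
    ⟨1, by decide, trivial, 0, by decide, fun i => i.elim⟩
  match p, i with
  | (a, none), 0 => exact (h a).mono (by decide)
  | (a, none), 1 => exact ⟨2, by decide, h a, trivial⟩
  | (a, none), 2 => exact (h a).mono (by decide)
  | (a, some b), 0 => trivial
  | (a, some b), 1 => exact ⟨0, by decide, trivial, trivial⟩
  | (a, some b), 2 => exact (h b).mono (by decide)

/-- A choice of a member in each of the disjunctions `diagramMember` describes an interpretation. -/
theorem exists_describes {T : Set (InfForm A)} {Γ : Finset (InfForm A)} (hΓ : CtxFiniteRank Γ)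
    (g : A × Option A → Fin 3) (hg : ∀ p, HT T Γ (diagramMember p (g p))) :
    ∃ I M, Describes T Γ I M := by
  have hnn {a : A} (h : HT T Γ (.atom a)) : HT T Γ (.neg (.neg (.atom a))) :=
    HT.imp_intro hΓ (finiteRank_atom a).neg fun Δ hΔ hfr d =>
      (d : HT T Δ (.imp _ _)).mp (h.mono hfr hΔ)
  have hwem (a : A) : HT T Γ (.neg (.atom a)) ∨ HT T Γ (.neg (.neg (.atom a))) := by
    have h := hg (a, none)
    match hi : g (a, none) with
    | 0 => rw [hi] at h; exact Or.inl h
    | 1 =>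
      rw [hi] at h
      exact Or.inr (HT.imp_intro hΓ (finiteRank_atom a).neg fun Δ hΔ hfr d =>
        (d : HT T Δ (.imp _ _)).mp ((h.mono hfr hΔ : HT T Δ (.imp _ _)).mp d))
    | 2 => rw [hi] at h; exact Or.inl h
  -- The atoms true here are the provable ones, the atoms true there are those whose negation is
  -- refutable.
  let I : Bool → A → Prop := fun w a =>
    if w then HT T Γ (.neg (.neg (.atom a))) else HT T Γ (.atom a)
  have himp (a b : A) (ha : ¬ I false a) (hb : I true b) : HT T Γ (.imp (.atom a) (.atom b)) := by
    have h := hg (a, some b)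
    match hi : g (a, some b) with
    | 0 => rw [hi] at h; exact absurd h ha
    | 1 => rw [hi] at h; exact h
    | 2 =>
      rw [hi] at h
      exact absurd (HT.ex_falso hΓ (finiteRank_atom a) ((hb : HT T Γ (.imp _ _)).mp h)) ha
  by_cases hm : ∃ m, I true m ∧ ¬ I false m
  · obtain ⟨m, hm1, hm2⟩ := hm
    exact ⟨I, .atom m, hΓ, finiteRank_atom m, fun a h => hnn h, hm1, fun a h => h,
      fun a h => (hwem a).resolve_right h, fun a h1 h2 => ⟨himp a m h2 hm1, himp m a hm2 h1⟩⟩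
  · refine ⟨I, .top, hΓ, finiteRank_top, fun a h => hnn h, ?_, fun a h => h,
      fun a h => (hwem a).resolve_right h, fun a h1 h2 => absurd ⟨a, h1, h2⟩ hm⟩
    exact HT.imp_intro hΓ finiteRank_top.neg fun Δ hΔ hfr d =>
      (d : HT T Δ (.imp _ _)).mp (HT.top_intro hfr)

/-- Strong completeness: a formula that holds in all worlds of two-world models in which the axioms
hold is a theorem of the infinitary logic of here-and-there extended by these axioms. -/
theorem HT.complete [Nonempty A] {T : Set (InfForm A)} (hT : ∀ G ∈ T, G.FiniteRank)
    {F : InfForm A} (hF : F.FiniteRank)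
    (h : ∀ (I : Bool → A → Prop) (w : Bool), (∀ a, I false a → I true a) →
      (∀ G ∈ T, G.Sat I w) → F.Sat I w) : HT T ∅ F := by
  have hfr : (InfForm.conj (A × Option A) fun p => .disj (Fin 3) (diagramMember p)).FiniteRank :=
    finiteRank_conj_iff.2 ⟨4, fun p => ⟨3, by decide, depthLE_diagramMember p⟩⟩
  have hdisj : HT T ∅ (.conj (A × Option A) fun p => .disj (Fin 3) (diagramMember p)) := by
    refine HT.conjI _ _ _ ctxFiniteRank_empty hfr ?_
    rintro ⟨a, _ | b⟩
    · exact HT.hosoi_flat (finiteRank_atom a).neg (finiteRank_atom a)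
    · exact HT.hosoi_flat (finiteRank_atom a) (finiteRank_atom b)
  have hfr' : (InfForm.disj (A × Option A → Fin 3) fun g =>
      .conj (A × Option A) fun p => diagramMember p (g p)).FiniteRank :=
    finiteRank_disj_iff.2 ⟨4, fun g => ⟨3, by decide, fun p => depthLE_diagramMember p _⟩⟩
  refine HT.disj_elim ctxFiniteRank_empty hfr' hF
    ((HT.distr (A × Option A) (fun _ => Fin 3) diagramMember hfr).mp hdisj) ?_
  intro g Γ _ hΓ d
  obtain ⟨I, M, hI⟩ := exists_describes hΓ g fun p => HT.conjE _ _ _ p d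
  have hax : ∀ G ∈ T, HT T Γ G := fun G hG =>
    (HT.extra G hG (hT G hG)).mono hΓ (Finset.empty_subset _)
  obtain ⟨F1, -, F3⟩ := hI.decides F hF
  by_cases hhere : ∀ G ∈ T, G.Sat I false
  · exact F1 (h I false hI.mono hhere)
  by_cases hthere : ∀ G ∈ T, G.Sat I true
  · -- An axiom with the value in the middle makes `M` provable.
    push Not at hhere
    obtain ⟨G, hG, hGs⟩ := hhere
    have hM := ((hI.decides G (hT G hG)).2.2 (hthere G hG) hGs).1.mp (hax G hG)
    by_cases hFs : F.Sat I false
    · exact F1 hFs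
    · exact (F3 (h I true hI.mono hthere) hFs).2.mp hM
  · push Not at hthere
    obtain ⟨G, hG, hGs⟩ := hthere
    exact HT.ex_falso hΓ hF (((hI.decides G (hT G hG)).2.1 hGs : HT T Γ (.imp _ _)).mp (hax G hG))

/-! ### Here-and-there satisfaction of first-order formulas -/

/-- The value of a term of the sort integer under an assignment of values to variables. -/
def ITerm.eval (η : IVar → ℤ) : ITerm → ℤ
  | .num n => n
  | .var i => η i
  | .add s t => s.eval η + t.eval η
  | .sub s t => s.eval η - t.eval η
  | .mul s t => s.eval η * t.eval η

/-- The value of a term under assignments of values to general variables and integer variables. -/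
def GTerm.eval (ρ : Var → Precomputed) (η : IVar → ℤ) : GTerm → Precomputed
  | .int t => .num (t.eval η)
  | .sym c => .sym c
  | .inf => .inf
  | .sup => .sup
  | .var x => ρ x

theorem ITerm.eval_congr {η η' : IVar → ℤ} {t : ITerm} (h : ∀ i ∈ t.vars, η i = η' i) :
    t.eval η = t.eval η' := by
  induction t <;> simp_all [ITerm.eval, ITerm.vars]

theorem GTerm.eval_congr {ρ ρ' : Var → Precomputed} {η η' : IVar → ℤ} {t : GTerm}
    (hρ : ∀ x ∈ t.varsG, ρ x = ρ' x) (hη : ∀ i ∈ t.varsI, η i = η' i) :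
    t.eval ρ η = t.eval ρ' η' := by
  cases t with
  | int t => exact congrArg _ (ITerm.eval_congr hη)
  | var x => exact hρ x (by simp [GTerm.varsG])
  | _ => rfl

theorem ITerm.eval_subst (η : IVar → ℤ) (τ : IVar → ITerm) (t : ITerm) :
    (t.subst τ).eval η = t.eval fun i => (τ i).eval η := by
  induction t <;> simp_all [ITerm.eval, ITerm.subst]

theorem GTerm.eval_subst (ρ : Var → Precomputed) (η : IVar → ℤ) (σ : Var → GTerm)
    (τ : IVar → ITerm) (t : GTerm) :
    (t.subst σ τ).eval ρ η = t.eval (fun x => (σ x).eval ρ η) fun i => (τ i).eval η := by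
  cases t with
  | int t => exact congrArg _ (ITerm.eval_subst η τ t)
  | _ => rfl

@[simp] theorem Precomputed.eval_toGTerm (ρ : Var → Precomputed) (η : IVar → ℤ)
    (r : Precomputed) : r.toGTerm.eval ρ η = r := by
  cases r <;> rfl

@[simp] theorem Precomputed.varsG_toGTerm (r : Precomputed) : r.toGTerm.varsG = ∅ := by
  cases r <;> rfl

@[simp] theorem Precomputed.varsI_toGTerm (r : Precomputed) : r.toGTerm.varsI = ∅ := by
  cases r <;> rfl

theorem ITerm.value_eq_eval (t : ITerm) : t.value = t.eval fun _ => 0 := by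
  induction t <;> simp_all [ITerm.eval, ITerm.value]

theorem GTerm.value_eq_eval (t : GTerm) : t.value = t.eval (fun _ => .inf) fun _ => 0 := by
  cases t with
  | int t => exact congrArg _ t.value_eq_eval
  | _ => rfl

namespace Fml

variable {P : Type} {ar : P → ℕ} [LinearOrder Precomputed]

/-- Satisfaction of a first-order formula at a world of a two-world Kripke model with the domain of
precomputed terms, under the assignment `ρ` of values to general variables and `η` to integer
variables. -/
def Sat (I : Bool → GAtom P ar → Prop) :
    Fml P ar → (Var → Precomputed) → (IVar → ℤ) → Bool → Prop
  | falsum, _, _, _ => False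
  | cmp op s t, ρ, η, _ => op.Holds (s.eval ρ η) (t.eval ρ η)
  | pred p args, ρ, η, w => I w ⟨p, fun i => (args i).eval ρ η⟩
  | and F G, ρ, η, w => F.Sat I ρ η w ∧ G.Sat I ρ η w
  | or F G, ρ, η, w => F.Sat I ρ η w ∨ G.Sat I ρ η w
  | imp F G, ρ, η, w => ∀ v, w ≤ v → F.Sat I ρ η v → G.Sat I ρ η v
  | allG x F, ρ, η, w => ∀ r, F.Sat I (Function.update ρ x r) η w
  | exG x F, ρ, η, w => ∃ r, F.Sat I (Function.update ρ x r) η w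
  | allI i F, ρ, η, w => ∀ n, F.Sat I ρ (Function.update η i n) w
  | exI i F, ρ, η, w => ∃ n, F.Sat I ρ (Function.update η i n) w

variable {I : Bool → GAtom P ar → Prop} {F G : Fml P ar} {ρ ρ' : Var → Precomputed}
  {η η' : IVar → ℤ} {w : Bool}

theorem sat_congr (hρ : ∀ x ∈ F.freeG, ρ x = ρ' x) (hη : ∀ i ∈ F.freeI, η i = η' i) :
    F.Sat I ρ η w ↔ F.Sat I ρ' η' w := by
  induction F generalizing ρ ρ' η η' w with
  | falsum => rfl
  | cmp op s t =>
    simp only [freeG, freeI, Finset.mem_union] at hρ hη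
    simp only [Sat]
    rw [GTerm.eval_congr (fun x hx => hρ x (.inl hx)) (fun i hi => hη i (.inl hi)),
      GTerm.eval_congr (fun x hx => hρ x (.inr hx)) (fun i hi => hη i (.inr hi))]
  | pred p args =>
    simp only [freeG, freeI, Finset.mem_biUnion, Finset.mem_univ, true_and] at hρ hη
    simp only [Sat]
    rw [show (fun j => (args j).eval ρ η) = fun j => (args j).eval ρ' η' from funext fun j =>
      GTerm.eval_congr (fun x hx => hρ x ⟨j, hx⟩) (fun i hi => hη i ⟨j, hi⟩)]
  | and F G ihF ihG | or F G ihF ihG | imp F G ihF ihG =>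
    simp only [freeG, freeI, Finset.mem_union] at hρ hη
    have hF := fun w => ihF (w := w) (fun x hx => hρ x (.inl hx)) (fun i hi => hη i (.inl hi))
    have hG := fun w => ihG (w := w) (fun x hx => hρ x (.inr hx)) (fun i hi => hη i (.inr hi))
    simp only [Sat, hF, hG]
  | allG x F ih | exG x F ih =>
    simp only [freeG, Finset.mem_sdiff, Finset.mem_singleton] at hρ
    have h (r) := ih (w := w) (ρ := Function.update ρ x r) (ρ' := Function.update ρ' x r)
      (fun y hy => by
        by_cases hyx : y = x
        · subst hyx; simp
        · simp [hyx, hρ y ⟨hy, hyx⟩]) hη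
    simp only [Sat, h]
  | allI x F ih | exI x F ih =>
    simp only [freeI, Finset.mem_sdiff, Finset.mem_singleton] at hη
    have h (r) := ih (w := w) (η := Function.update η x r) (η' := Function.update η' x r) hρ
      (fun y hy => by
        by_cases hyx : y = x
        · subst hyx; simp
        · simp [hyx, hη y ⟨hy, hyx⟩])
    simp only [Sat, h]

/-- Substitution amounts to a change of the assignment, provided that it does not lead to capture
of variables: a variable distinct from `x` that occurs in the term substituted for `x` does not
occur in the formula. -/
theorem sat_subst {σ : Var → GTerm} {τ : IVar → ITerm}
    (hσ : ∀ x, ∀ y ∈ (σ x).varsG, y = x ∨ y ∉ F.occG) (hσI : ∀ x, (σ x).varsI = ∅)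
    (hτ : ∀ i, ∀ j ∈ (τ i).vars, j = i) :
    (F.subst σ τ).Sat I ρ η w ↔
      F.Sat I (fun x => (σ x).eval ρ η) (fun i => (τ i).eval η) w := by
  induction F generalizing σ τ ρ η w with
  | falsum => rfl
  | cmp op s t => simp only [subst, Sat, GTerm.eval_subst]
  | pred p args => simp only [subst, Sat, GTerm.eval_subst]
  | and F G ihF ihG | or F G ihF ihG | imp F G ihF ihG =>
    simp only [occG, Finset.mem_union, not_or] at hσ
    have hF := fun w => ihF (w := w) (ρ := ρ) (η := η)
      (fun x y hy => (hσ x y hy).imp_right And.left) hσI hτ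
    have hG := fun w => ihG (w := w) (ρ := ρ) (η := η)
      (fun x y hy => (hσ x y hy).imp_right And.right) hσI hτ
    simp only [subst, Sat, hF, hG]
  | allG x F ih | exG x F ih =>
    simp only [occG, Finset.mem_insert, not_or] at hσ
    have h (r) := ih (w := w) (ρ := Function.update ρ x r) (η := η) (τ := τ)
      (σ := Function.update σ x (.var x)) (fun y z hz => by
        by_cases hyx : y = x
        · subst hyx; simpa [GTerm.varsG] using Or.inl hz
        · rw [Function.update_of_ne hyx] at hz
          exact (hσ y z hz).imp_right And.right)
      (fun y => by
        by_cases hyx : y = x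
        · subst hyx; simp [GTerm.varsI]
        · rw [Function.update_of_ne hyx, hσI]) hτ
    have e (r) : (fun y => (Function.update σ x (.var x) y).eval (Function.update ρ x r) η) =
        Function.update (fun y => (σ y).eval ρ η) x r := by
      funext y
      by_cases hyx : y = x
      · subst hyx; simp [GTerm.eval]
      · rw [Function.update_of_ne hyx, Function.update_of_ne hyx]
        refine GTerm.eval_congr (fun z hz => ?_) fun _ _ => rfl
        refine Function.update_of_ne ?_ _ _
        rintro rfl
        exact (hσ y z hz).elim (fun h => hyx h.symm) fun h => h.1 rfl
    simp only [subst, Sat, h, e]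
  | allI x F ih | exI x F ih =>
    have h (r) := ih (w := w) (ρ := ρ) (η := Function.update η x r) (σ := σ)
      (τ := Function.update τ x (.var x)) hσ hσI (fun y z hz => by
        by_cases hyx : y = x
        · subst hyx; simpa [ITerm.vars] using hz
        · rw [Function.update_of_ne hyx] at hz
          exact hτ y z hz)
    have e (r) : (fun y => (Function.update τ x (.var x) y).eval (Function.update η x r)) =
        Function.update (fun y => (τ y).eval η) x r := by
      funext y
      by_cases hyx : y = x
      · subst hyx; simp [ITerm.eval]
      · rw [Function.update_of_ne hyx, Function.update_of_ne hyx]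
        refine ITerm.eval_congr fun z hz => Function.update_of_ne ?_ _ _
        rintro rfl
        exact hyx (hτ y z hz).symm
    have e' (r) : (fun y => (σ y).eval ρ (Function.update η x r)) = fun y => (σ y).eval ρ η :=
      funext fun y => GTerm.eval_congr (fun _ _ => rfl) (by simp [hσI])
    simp only [subst, Sat, h, e, e']

theorem sat_instG {x : Var} {r : Precomputed} :
    (F.instG x r).Sat I ρ η w ↔ F.Sat I (Function.update ρ x r) η w := by
  rw [instG, sat_subst]
  · have : (fun y => (Function.update GTerm.var x r.toGTerm y).eval ρ η) =
        Function.update ρ x r := by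
      funext y
      by_cases hyx : y = x
      · subst hyx; simp
      · simp [hyx, GTerm.eval]
    rw [this]
    rfl
  · intro y z hz
    by_cases hyx : y = x
    · subst hyx; simp at hz
    · left; simpa [hyx, GTerm.varsG] using hz
  · intro y
    by_cases hyx : y = x
    · subst hyx; simp
    · simp [hyx, GTerm.varsI]
  · simp [ITerm.vars]

theorem sat_instI {i : IVar} {n : ℤ} :
    (F.instI i n).Sat I ρ η w ↔ F.Sat I ρ (Function.update η i n) w := by
  rw [instI, sat_subst]
  · have : (fun j => (Function.update ITerm.var i (.num n) j).eval η) =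
        Function.update η i n := by
      funext y
      by_cases hyx : y = i
      · subst hyx; simp [ITerm.eval]
      · simp [hyx, ITerm.eval]
    rw [this]
    rfl
  · simp [GTerm.varsG]
  · simp [GTerm.varsI]
  · intro y z hz
    by_cases hyx : y = i
    · subst hyx; simp [ITerm.vars] at hz
    · simpa [hyx, ITerm.vars] using hz

/-- Grounding preserves satisfaction. For formulas with free variables, the right-hand side
reflects the junk values that `gr` uses for them. -/
theorem sat_gr : (gr F).Sat I w ↔ F.Sat I (fun _ => .inf) (fun _ => 0) w := by
  induction h : F.depth using Nat.strong_induction_on generalizing F w with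
  | _ n ih =>
  subst h
  have ih (G : Fml P ar) (hG : G.depth < F.depth) (w) := ih _ hG (F := G) (w := w) rfl
  cases F with
  | falsum => simp [gr, Sat]
  | cmp op s t =>
    simp only [gr, Sat, GTerm.value_eq_eval]
    split_ifs with h <;> simp [h]
  | pred p args => simp only [gr, Sat, InfForm.Sat, GTerm.value_eq_eval]
  | and F G =>
    simp only [gr, InfForm.sat_and, Sat, ih F (by simp only [depth]; omega),
      ih G (by simp only [depth]; omega)]
  | or F G =>
    simp only [gr, InfForm.sat_or, Sat, ih F (by simp only [depth]; omega),
      ih G (by simp only [depth]; omega)]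
  | imp F G =>
    simp only [gr, InfForm.Sat, Sat, ih F (by simp only [depth]; omega),
      ih G (by simp only [depth]; omega)]
  | allG x F | exG x F =>
    have := fun r => ih (F.instG x r) (by simp [depth, instG, depth_subst])
    simp only [gr, InfForm.Sat, Sat, this, sat_instG]
  | allI i F | exI i F =>
    have := fun n => ih (F.instI i n) (by simp [depth, instI, depth_subst])
    simp only [gr, InfForm.Sat, Sat, this, sat_instI]

theorem depthLE_gr : (gr F).DepthLE (F.depth + 1) := by
  have hbot : (InfForm.bot : InfForm (GAtom P ar)).DepthLE 1 :=
    ⟨0, by decide, fun i => i.elim⟩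
  have htop : (InfForm.top : InfForm (GAtom P ar)).DepthLE 1 :=
    ⟨0, by decide, fun i => i.elim⟩
  induction h : F.depth using Nat.strong_induction_on generalizing F with
  | _ n ih =>
  subst h
  have ih (G : Fml P ar) (m) (hG : G.depth < m) (hm : m ≤ F.depth) :=
    (ih _ (hG.trans_le hm) (F := G) rfl).mono hG
  cases F with
  | falsum => rw [gr]; exact hbot
  | cmp op s t =>
    rw [gr]
    split_ifs
    exacts [htop, hbot]
  | pred p args => rw [gr]; trivial
  | and F G | or F G =>
    rw [gr]
    refine ⟨_, Nat.lt_succ_self _, ?_⟩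
    rintro (_ | _)
    · exact ih G _ (by simp only [depth]; omega) le_rfl
    · exact ih F _ (by simp only [depth]; omega) le_rfl
  | imp F G =>
    rw [gr]
    exact ⟨_, Nat.lt_succ_self _, ih F _ (by simp only [depth]; omega) le_rfl,
      ih G _ (by simp only [depth]; omega) le_rfl⟩
  | allG x F | exG x F =>
    rw [gr]
    exact ⟨_, Nat.lt_succ_self _, fun r => ih _ _ (by simp [depth, instG, depth_subst]) le_rfl⟩
  | allI i F | exI i F =>
    rw [gr]
    exact ⟨_, Nat.lt_succ_self _, fun r => ih _ _ (by simp [depth, instI, depth_subst]) le_rfl⟩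

@[simp] theorem sat_neg : (neg F).Sat I ρ η w ↔ ∀ v, w ≤ v → ¬ F.Sat I ρ η v := by
  simp [neg, Sat]

@[simp] theorem sat_top : (top : Fml P ar).Sat I ρ η w := fun _ _ h => h

theorem sat_iff :
    (iff F G).Sat I ρ η w ↔ ∀ v, w ≤ v → (F.Sat I ρ η v ↔ G.Sat I ρ η v) := by
  simp only [iff, Sat]
  exact ⟨fun h v hv => ⟨h.1 v hv, h.2 v hv⟩,
    fun h => ⟨fun v hv => (h v hv).1, fun v hv => (h v hv).2⟩⟩

theorem sat_conjList {Fs : List (Fml P ar)} :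
    (conjList Fs).Sat I ρ η w ↔ ∀ F ∈ Fs, F.Sat I ρ η w := by
  induction Fs with
  | nil => simp [conjList]
  | cons F Fs ih => simp [conjList, Sat, ih]

theorem sat_disjList {Fs : List (Fml P ar)} :
    (disjList Fs).Sat I ρ η w ↔ ∃ F ∈ Fs, F.Sat I ρ η w := by
  induction Fs with
  | nil => simp [disjList, Sat]
  | cons F Fs ih => simp [disjList, Sat, ih]

theorem sat_exList {xs : List Var} :
    (exList xs F).Sat I ρ η w ↔ ∃ ρ', (∀ y ∉ xs, ρ' y = ρ y) ∧ F.Sat I ρ' η w := by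
  induction xs generalizing ρ with
  | nil =>
    refine ⟨fun h => ⟨ρ, fun _ _ => rfl, h⟩, fun ⟨ρ', h, hF⟩ => ?_⟩
    rwa [show ρ' = ρ from funext fun y => h y (by simp)] at hF
  | cons x xs ih =>
    have e : (exList (x :: xs) F).Sat I ρ η w ↔
        ∃ r, (exList xs F).Sat I (Function.update ρ x r) η w := Iff.rfl
    simp only [e, ih]
    constructor
    · rintro ⟨r, ρ', h, hF⟩
      refine ⟨ρ', fun y hy => ?_, hF⟩
      simp only [List.mem_cons, not_or] at hy
      rw [h y hy.2, Function.update_of_ne hy.1]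
    · rintro ⟨ρ', h, hF⟩
      refine ⟨ρ' x, ρ', fun y hy => ?_, hF⟩
      by_cases hyx : y = x
      · subst hyx; simp
      · rw [Function.update_of_ne hyx, h y (by simp [hyx, hy])]

theorem sat_allList {xs : List Var} :
    (allList xs F).Sat I ρ η w ↔ ∀ ρ', (∀ y ∉ xs, ρ' y = ρ y) → F.Sat I ρ' η w := by
  induction xs generalizing ρ with
  | nil =>
    refine ⟨fun h ρ' h' => ?_, fun h => h ρ fun _ _ => rfl⟩
    rwa [show ρ' = ρ from funext fun y => h' y (by simp)]
  | cons x xs ih =>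
    have e : (allList (x :: xs) F).Sat I ρ η w ↔
        ∀ r, (allList xs F).Sat I (Function.update ρ x r) η w := Iff.rfl
    simp only [e, ih]
    constructor
    · intro H ρ' h
      refine H (ρ' x) ρ' fun y hy => ?_
      by_cases hyx : y = x
      · subst hyx; simp
      · rw [Function.update_of_ne hyx, h y (by simp [hyx, hy])]
    · intro H r ρ' h
      refine H ρ' fun y hy => ?_
      simp only [List.mem_cons, not_or] at hy
      rw [h y hy.2, Function.update_of_ne hy.1]

theorem sat_lift {I : Bool → ExtAtom → Prop} {F : Fml₀} {ρ : Var → Precomputed} {η : IVar → ℤ}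
    {w : Bool} : F.lift.Sat I ρ η w ↔ F.Sat (fun w a => I w (PreAtom.toExt a)) ρ η w := by
  induction F generalizing ρ η w with
  | falsum => rfl
  | cmp op s t => rfl
  | pred p args => rfl
  | and F G ihF ihG | or F G ihF ihG | imp F G ihF ihG => simp only [lift, Sat, ihF, ihG]
  | allG x F ih | exG x F ih | allI x F ih | exI x F ih => simp only [lift, Sat, ih]

end Fml

/-! ### Substituting precomputed terms in rules -/

theorem Term.subst_congr {σ σ' : Assignment} {t : Term} (h : ∀ x ∈ t.vars, σ x = σ' x) :
    t.subst σ = t.subst σ' := by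
  induction t <;> simp_all [Term.subst, Term.vars]

theorem Term.subst_subst (σ σ' : Assignment) (t : Term) :
    (t.subst σ).subst σ' = t.subst fun x => (σ x).or (σ' x) := by
  induction t with
  | pre r => rfl
  | var x => cases h : σ x <;> simp [Term.subst, h]
  | bin op t₁ t₂ h₁ h₂ => simp [Term.subst, h₁, h₂]

theorem Term.mem_vars_subst {σ : Assignment} {t : Term} {x : Var} :
    x ∈ (t.subst σ).vars ↔ x ∈ t.vars ∧ σ x = none := by
  induction t with
  | pre r => simp [Term.subst, Term.vars]
  | var y =>
    cases h : σ y <;> simp only [Term.subst, h, Term.vars, Finset.mem_singleton,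
      Finset.notMem_empty, false_iff, iff_self_and]
    · rintro rfl; exact h
    · rintro ⟨rfl, h'⟩; simp [h] at h'
  | bin op t₁ t₂ h₁ h₂ => simp [Term.subst, Term.vars, h₁, h₂, or_and_right]

theorem Atom.mem_vars {a : Atom} {x : Var} : x ∈ a.vars ↔ ∃ i, x ∈ (a.args i).vars := by
  simp [Atom.vars]

theorem Atom.subst_congr {σ σ' : Assignment} {a : Atom} (h : ∀ x ∈ a.vars, σ x = σ' x) :
    a.subst σ = a.subst σ' := by
  have : (fun i => (a.args i).subst σ) = fun i => (a.args i).subst σ' := funext fun i =>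
    Term.subst_congr fun x hx => h x (Atom.mem_vars.2 ⟨i, hx⟩)
  simp only [Atom.subst, this]

theorem BasicElem.subst_congr {σ σ' : Assignment} {b : BasicElem}
    (h : ∀ x ∈ b.vars, σ x = σ' x) : b.subst σ = b.subst σ' := by
  cases b with
  | lit s a => exact congrArg _ (Atom.subst_congr h)
  | cmp op t₁ t₂ =>
    simp only [BasicElem.vars, Finset.mem_union] at h
    simp only [BasicElem.subst]
    rw [Term.subst_congr fun x hx => h x (.inl hx), Term.subst_congr fun x hx => h x (.inr hx)]

theorem BasicElem.subst_subst (σ σ' : Assignment) (b : BasicElem) :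
    (b.subst σ).subst σ' = b.subst fun x => (σ x).or (σ' x) := by
  cases b <;> simp [BasicElem.subst, Atom.subst, Term.subst_subst]

theorem BasicElem.mem_vars_subst {σ : Assignment} {b : BasicElem} {x : Var} :
    x ∈ (b.subst σ).vars ↔ x ∈ b.vars ∧ σ x = none := by
  cases b with
  | lit s a =>
    simp only [BasicElem.subst, BasicElem.vars, Atom.mem_vars, Atom.subst, Term.mem_vars_subst,
      exists_and_right]
  | cmp op t₁ t₂ =>
    simp [BasicElem.subst, BasicElem.vars, Term.mem_vars_subst, or_and_right]

theorem mem_basicVars {L : List BasicElem} {x : Var} :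
    x ∈ basicVars L ↔ ∃ b ∈ L, x ∈ b.vars := by
  induction L with
  | nil => simp [basicVars]
  | cons b L ih => simp [basicVars, ih]

theorem mem_basicVars_subst {σ : Assignment} {L : List BasicElem} {x : Var} :
    x ∈ basicVars (L.map (BasicElem.subst σ)) ↔ x ∈ basicVars L ∧ σ x = none := by
  simp [mem_basicVars, BasicElem.mem_vars_subst, ← and_assoc, exists_and_right]

/-- The assignment, defined everywhere, that is given by the values of general variables. -/
def closing (ρ : Var → Precomputed) : Assignment := fun x => some (ρ x)

/-- A ground instance of an interval-free term has at most one value. The substitution `σ` is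
arbitrary because, by convention, a variable has no values. -/
theorem Term.subsingleton_values {t : Term} (h : t.IntervalFree) (σ : Assignment) :
    (t.subst σ).values.Subsingleton := by
  induction t with
  | pre r => exact Set.subsingleton_singleton
  | var x =>
    cases hx : σ x <;> simp only [Term.subst, hx, Term.values]
    exacts [Set.subsingleton_empty, Set.subsingleton_singleton]
  | bin op t₁ t₂ h₁ h₂ =>
    have key (f : ℤ → ℤ → ℤ) {m n m' n' : ℤ} (hm : t₁.IntervalFree) (hn : t₂.IntervalFree)
        (a : Precomputed.num m ∈ (t₁.subst σ).values) (b : Precomputed.num n ∈ (t₂.subst σ).values)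
        (c : Precomputed.num m' ∈ (t₁.subst σ).values)
        (d : Precomputed.num n' ∈ (t₂.subst σ).values) :
        Precomputed.num (f m n) = .num (f m' n') := by
      have := h₁ hm a c
      have := h₂ hn b d
      simp_all
    cases op with
    | interval => exact h.elim
    | add =>
      rintro _ ⟨m, n, hm, hn, rfl⟩ _ ⟨m', n', hm', hn', rfl⟩
      exact key (fun m n => m + n) h.1 h.2 hm hn hm' hn'
    | sub =>
      rintro _ ⟨m, n, hm, hn, rfl⟩ _ ⟨m', n', hm', hn', rfl⟩
      exact key (fun m n => m - n) h.1 h.2 hm hn hm' hn'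
    | mul =>
      rintro _ ⟨m, n, hm, hn, rfl⟩ _ ⟨m', n', hm', hn', rfl⟩
      exact key (fun m n => m * n) h.1 h.2 hm hn hm' hn'
    | div =>
      rintro _ ⟨m, n, hm, hn, -, rfl⟩ _ ⟨m', n', hm', hn', -, rfl⟩
      exact key (fun m n => ⌊(m : ℚ) / n⌋) h.1 h.2 hm hn hm' hn'
    | mod =>
      rintro _ ⟨m, n, hm, hn, -, rfl⟩ _ ⟨m', n', hm', hn', -, rfl⟩
      exact key (fun m n => m - n * ⌊(m : ℚ) / n⌋) h.1 h.2 hm hn hm' hn'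

/-! ### The formulas expressing that a term has a given value -/

/-- The formula `D` in the definition of `val` for `/` and `\` defines division with rounding down.
The remainder has the sign of the divisor. -/
theorem quotient_remainder_iff {m n q s : ℤ} :
    (m = n * q + s ∧ n ≠ 0 ∧ (0 ≤ s ∧ s < n ∨ n < s ∧ s ≤ 0)) ↔
      n ≠ 0 ∧ q = ⌊(m : ℚ) / n⌋ ∧ s = m - n * ⌊(m : ℚ) / n⌋ := by
  have key (hn : n ≠ 0) : q = ⌊(m : ℚ) / n⌋ ↔
      (0 ≤ m - n * q ∧ m - n * q < n ∨ n < m - n * q ∧ m - n * q ≤ 0) := by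
    rw [eq_comm, Int.floor_eq_iff]
    rcases lt_or_gt_of_ne hn with h | h
    · have h' : (n : ℚ) < 0 := by exact_mod_cast h
      rw [le_div_iff_of_neg h', div_lt_iff_of_neg h']
      norm_cast
      constructor
      · rintro ⟨h1, h2⟩; right; constructor <;> linarith
      · rintro (⟨h1, h2⟩ | ⟨h1, h2⟩)
        · linarith
        · constructor <;> linarith
    · have h' : (0 : ℚ) < n := by exact_mod_cast h
      rw [le_div_iff₀ h', div_lt_iff₀ h']
      norm_cast
      constructor
      · rintro ⟨h1, h2⟩; left; constructor <;> linarith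
      · rintro (⟨h1, h2⟩ | ⟨h1, h2⟩)
        · constructor <;> linarith
        · linarith
  constructor
  · rintro ⟨rfl, hn, h⟩
    have hq := (key hn).2 (by simpa using h)
    exact ⟨hn, hq, by rw [← hq]; ring⟩
  · rintro ⟨hn, rfl, rfl⟩
    exact ⟨by ring, hn, (key hn).1 rfl⟩

theorem GTerm.eval_update {Z : GTerm} {i : IVar} {ρ : Var → Precomputed} {η : IVar → ℤ}
    (h : i ∉ Z.varsI) (n : ℤ) :
    Z.eval ρ (Function.update η i n) = Z.eval ρ η :=
  GTerm.eval_congr (fun _ _ => rfl) fun j hj =>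
    Function.update_of_ne (by rintro rfl; exact h hj) _ _

theorem mem_varTuple {z n : ℕ} {y : Var} : y ∈ varTuple z n ↔ ∃ i < n, y = z + i := by
  simp [varTuple, eq_comm]

theorem lt_freshFrom {S : Finset Var} {x : Var} (h : x ∈ S) : x < freshFrom S :=
  Nat.lt_succ_of_le (Finset.le_sup (f := id) h)

/-- An assignment can be changed on a tuple of consecutive variables in an arbitrary way. -/
theorem exists_assignment_varTuple (ρ : Var → Precomputed) (z : Var) {n : ℕ}
    (r : Fin n → Precomputed) :
    ∃ ρ' : Var → Precomputed, (∀ y ∉ varTuple z n, ρ' y = ρ y) ∧ ∀ i : Fin n, ρ' (z + i) = r i := by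
  refine ⟨fun y => if h : z ≤ y ∧ y - z < n then r ⟨y - z, h.2⟩ else ρ y, fun y hy => ?_,
    fun i => ?_⟩
  · refine dif_neg fun h => hy (mem_varTuple.2 ⟨y - z, h.2, (Nat.add_sub_cancel' h.1).symm⟩)
  · simp

/-- The tuples of values of a ground instance of an atom correspond to the tuples of values of fresh
variables that satisfy the formula `val`. -/
theorem forall_values_iff {ρ : Var → Precomputed} {a : Atom} {z : Var}
    (hz : ∀ x ∈ a.vars, x < z) {σ : Assignment}
    (hσ : ∀ x ∈ a.vars, σ x = some (ρ x)) (Q : (Fin a.arity → Precomputed) → Prop) :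
    (∀ r : (a.subst σ).Values, Q r.1) ↔
      ∀ ρ' : Var → Precomputed, (∀ y ∉ varTuple z a.arity, ρ' y = ρ y) →
        (∀ i : Fin a.arity, ρ' (z + i) ∈ ((a.args i).subst (closing ρ')).values) →
          Q fun i => ρ' (z + i) := by
  have e (ρ' : Var → Precomputed) (h : ∀ y ∉ varTuple z a.arity, ρ' y = ρ y)
      (i : Fin a.arity) : (a.args i).subst (closing ρ') = (a.args i).subst σ :=
    Term.subst_congr fun x hx => by
      have hx := Atom.mem_vars.2 ⟨i, hx⟩
      rw [hσ x hx, closing, h]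
      rw [mem_varTuple]
      rintro ⟨j, -, rfl⟩
      exact absurd (hz _ hx) (by simp)
  constructor
  · intro H ρ' h hv
    exact H ⟨fun i => ρ' (z + i), fun i => by
      have := hv i
      rwa [e ρ' h i] at this⟩
  · intro H r
    obtain ⟨ρ', h, hr⟩ := exists_assignment_varTuple ρ z (n := a.arity) r.1
    have := H ρ' h fun i => by rw [e ρ' h i, hr]; exact r.2 i
    rwa [funext hr] at this

theorem exists_values_iff {ρ : Var → Precomputed} {a : Atom} {z : Var}
    (hz : ∀ x ∈ a.vars, x < z) {σ : Assignment}
    (hσ : ∀ x ∈ a.vars, σ x = some (ρ x)) (Q : (Fin a.arity → Precomputed) → Prop) :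
    (∃ r : (a.subst σ).Values, Q r.1) ↔
      ∃ ρ' : Var → Precomputed, (∀ y ∉ varTuple z a.arity, ρ' y = ρ y) ∧
        (∀ i : Fin a.arity, ρ' (z + i) ∈ ((a.args i).subst (closing ρ')).values) ∧
          Q fun i => ρ' (z + i) := by
  have := not_congr (forall_values_iff hz hσ fun r => ¬ Q r)
  push Not at this
  exact this

section

variable {P : Type} {ar : P → ℕ} [LinearOrder Precomputed] {I : Bool → GAtom P ar → Prop}
  {ρ : Var → Precomputed} {η : IVar → ℤ} {w : Bool}

theorem sat_divMod (hord : AdmissibleOrder) {k : ℕ} :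
    (val.divMod k : Fml P ar).Sat I ρ η w ↔ η (k + 1) ≠ 0 ∧
      η (k + 2) = ⌊(η k : ℚ) / η (k + 1)⌋ ∧
      η (k + 3) = η k - η (k + 1) * ⌊(η k : ℚ) / η (k + 1)⌋ := by
  have hlt (m n : ℤ) : Precomputed.num m < .num n ↔ m < n := by
    rw [← not_le, hord.num_le_num, not_le]
  rw [← quotient_remainder_iff]
  simp [val.divMod, Fml.sat_conjList, Fml.Sat, CmpOp.Holds, GTerm.eval, ITerm.eval,
    hord.num_le_num, hlt]

theorem sat_val (hord : AdmissibleOrder) {t : Term} {Z : GTerm} {k : ℕ}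
    (hZ : ∀ i ∈ Z.varsI, i < k) :
    (val t Z k : Fml P ar).Sat I ρ η w ↔ Z.eval ρ η ∈ (t.subst (closing ρ)).values := by
  induction t generalizing Z k η with
  | pre r => simp [val, Fml.Sat, CmpOp.Holds, Term.subst, Term.values]
  | var x => simp [val, Fml.Sat, CmpOp.Holds, Term.subst, Term.values, closing, GTerm.eval]
  | bin op t₁ t₂ h₁ h₂ =>
    have hk (j : ℕ) : k + j ∉ Z.varsI := fun h => absurd (hZ _ h) (Nat.le_add_right k j).not_gt
    have hk0 : k ∉ Z.varsI := hk 0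
    have e₁ (η : IVar → ℤ) (j : ℕ) : (val t₁ (.int (.var k)) (k + (j + 1)) : Fml P ar).Sat I ρ η w ↔
        Precomputed.num (η k) ∈ (t₁.subst (closing ρ)).values :=
      h₁ fun i hi => by
        obtain rfl : i = k := by simpa [GTerm.varsI, ITerm.vars] using hi
        exact Nat.lt_add_of_pos_right j.succ_pos
    have e₂ (η : IVar → ℤ) (j : ℕ) :
        (val t₂ (.int (.var (k + 1))) (k + (j + 2)) : Fml P ar).Sat I ρ η w ↔
        Precomputed.num (η (k + 1)) ∈ (t₂.subst (closing ρ)).values :=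
      h₂ fun i hi => by
        obtain rfl : i = k + 1 := by simpa [GTerm.varsI, ITerm.vars] using hi
        exact Nat.add_lt_add_left (by omega) k
    cases op with
    | add | sub | mul =>
      simp only [val, Fml.Sat, Fml.sat_conjList, List.mem_cons, List.not_mem_nil, or_false,
        forall_eq_or_imp, forall_eq, e₁ _ 1, e₂ _ 0, CmpOp.Holds, GTerm.eval_update (hk _),
        GTerm.eval_update hk0, Term.subst, Term.values, Set.mem_ofPred_eq]
      generalize Z.eval ρ η = z
      simp only [GTerm.eval, ITerm.eval, Function.update_self, ne_eq, Nat.left_eq_add,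
        one_ne_zero, not_false_eq_true, Function.update_of_ne]
      exact exists_congr fun m => exists_congr fun n => by tauto
    | div | mod =>
      simp only [val, Fml.Sat, Fml.sat_conjList, List.mem_cons, List.not_mem_nil, or_false,
        forall_eq_or_imp, forall_eq, e₁ _ 3, e₂ _ 2, CmpOp.Holds, GTerm.eval_update (hk _),
        GTerm.eval_update hk0, Term.subst, Term.values, Set.mem_ofPred_eq, sat_divMod hord]
      generalize Z.eval ρ η = z
      simp [GTerm.eval, ITerm.eval]
      grind
    | interval =>
      simp only [val, Fml.Sat, Fml.sat_conjList, List.mem_cons, List.not_mem_nil, or_false,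
        forall_eq_or_imp, forall_eq, e₁ _ 2, e₂ _ 1, CmpOp.Holds, GTerm.eval_update (hk _),
        GTerm.eval_update hk0, Term.subst, Term.values, Set.mem_ofPred_eq]
      generalize Z.eval ρ η = z
      simp [GTerm.eval, ITerm.eval, hord.num_le_num]

theorem sat_valArgs (hord : AdmissibleOrder) {a : Atom} {z : Var} :
    (valArgs a z : Fml P ar).Sat I ρ η w ↔
      ∀ i : Fin a.arity, ρ (z + i) ∈ ((a.args i).subst (closing ρ)).values := by
  simp only [valArgs, Fml.sat_conjList, List.mem_ofFn, forall_exists_index,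
    forall_apply_eq_imp_iff]
  exact forall_congr' fun i => sat_val hord (by simp [GTerm.varsI])

end

section

variable [LinearOrder Precomputed] {I : Bool → PreAtom → Prop}
  {ρ : Var → Precomputed} {η : IVar → ℤ} {w : Bool}

/-- The first-order translation of a literal or comparison has the same meaning as the
propositional translation of its ground instance. -/
theorem sat_tauB (hord : AdmissibleOrder) {b : BasicElem} {σ : Assignment}
    (hσ : ∀ x ∈ b.vars, σ x = some (ρ x)) :
    b.tauB.Sat I ρ η w ↔ (b.subst σ).tau.Sat I w := by
  cases b with
  | lit s a =>
    have hp (ρ' : Var → Precomputed) (w) (z : Var) : (predArgs a z).Sat I ρ' η w ↔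
      I w ⟨⟨a.name, a.arity⟩, fun i => ρ' (z + i)⟩ := Iff.rfl
    have hi (r) (w) : ((a.subst σ).inst r).Sat I w ↔ I w ⟨⟨a.name, a.arity⟩, r⟩ := Iff.rfl
    have key := exists_values_iff (a := a) (fun x hx => lt_freshFrom hx) hσ
    cases s with
    | pos =>
      simp only [BasicElem.tauB, Fml.sat_exList, Fml.Sat, sat_valArgs hord, BasicElem.subst,
        BasicElem.tau, InfForm.Sat, hp, hi]
      exact (key fun r => I w ⟨⟨a.name, a.arity⟩, r⟩).symm
    | neg =>
      simp only [BasicElem.tauB, Fml.sat_exList, Fml.Sat, sat_valArgs hord, BasicElem.subst,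
        BasicElem.tau, InfForm.Sat, hp, hi, Fml.sat_neg, InfForm.sat_neg]
      exact (key fun r => ∀ v, w ≤ v → ¬ I v ⟨⟨a.name, a.arity⟩, r⟩).symm
    | negneg =>
      simp only [BasicElem.tauB, Fml.sat_exList, Fml.Sat, sat_valArgs hord, BasicElem.subst,
        BasicElem.tau, InfForm.Sat, hp, hi, Fml.sat_neg, InfForm.sat_neg]
      exact (key fun r => ∀ v, w ≤ v → ¬ ∀ u, v ≤ u → ¬ I u ⟨⟨a.name, a.arity⟩, r⟩).symm
  | cmp op t₁ t₂ =>
    simp only [BasicElem.vars, Finset.mem_union] at hσ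
    have e (z : Var) (hz : freshFrom (t₁.vars ∪ t₂.vars) = z) (r₁ r₂ : Precomputed) :
        t₁.subst (closing (Function.update (Function.update ρ z r₁) (z + 1) r₂)) = t₁.subst σ ∧
        t₂.subst (closing (Function.update (Function.update ρ z r₁) (z + 1) r₂)) = t₂.subst σ := by
      have (x) (hx : x ∈ t₁.vars ∪ t₂.vars) :
          closing (Function.update (Function.update ρ z r₁) (z + 1) r₂) x = σ x := by
        have := lt_freshFrom hx
        rw [hσ x (Finset.mem_union.1 hx), closing,
          Function.update_of_ne (this.trans (hz ▸ Nat.lt_succ_self _)).ne,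
          Function.update_of_ne (hz ▸ this).ne]
      exact ⟨Term.subst_congr fun x hx => this x (Finset.mem_union_left _ hx),
        Term.subst_congr fun x hx => this x (Finset.mem_union_right _ hx)⟩
    have hv (z : Var) : ∀ i ∈ (GTerm.var z).varsI, i < 0 := by simp [GTerm.varsI]
    simp only [BasicElem.tauB, Fml.Sat, sat_val hord (hv _), (e _ rfl _ _).1, (e _ rfl _ _).2]
    simp only [GTerm.eval, Function.update_self, ne_eq, Nat.left_eq_add, one_ne_zero,
      not_false_eq_true, Function.update_of_ne, BasicElem.subst, BasicElem.tau]
    split_ifs with h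
    · simp only [InfForm.sat_top, iff_true]
      obtain ⟨r₁, h₁, r₂, h₂, h⟩ := h
      exact ⟨r₁, r₂, h₁, h₂, h⟩
    · simp only [InfForm.not_sat_bot, iff_false]
      rintro ⟨r₁, r₂, h₁, h₂, h'⟩
      exact h ⟨r₁, h₁, r₂, h₂, h'⟩

end

/-! ### Counting formulas -/

/-- The result of changing the values of the members of `xs` to the members of the tuple `r`. -/
def override (ρ : Var → Precomputed) (xs : List Var) (r : Fin xs.length → Precomputed) :
    Var → Precomputed := fun x => (assign xs r x).getD (ρ x)

section

variable {ρ ρ' : Var → Precomputed} {xs : List Var} {r : Fin xs.length → Precomputed} {x : Var}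

theorem assign_of_mem (h : x ∈ xs) :
    assign xs r x = some (r ⟨xs.idxOf x, List.idxOf_lt_length_of_mem h⟩) := dif_pos h

theorem assign_of_notMem (h : x ∉ xs) : assign xs r x = none := dif_neg h

theorem override_of_mem (h : x ∈ xs) : assign xs r x = some (override ρ xs r x) := by
  simp [override, assign_of_mem h]

theorem override_of_notMem (h : x ∉ xs) : override ρ xs r x = ρ x := by
  simp [override, assign_of_notMem h]

theorem override_congr_of_mem (h : x ∈ xs) : override ρ xs r x = override ρ' xs r x := by
  simp [override, assign_of_mem h]

theorem override_get (h : ∀ y ∉ xs, ρ' y = ρ y) : override ρ xs (fun k => ρ' (xs.get k)) = ρ' := by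
  funext x
  by_cases hx : x ∈ xs
  · simp [override, assign_of_mem hx]
  · rw [override_of_notMem hx, h x hx]

end

theorem Fml.freeG_subset_occG {P : Type} {ar : P → ℕ} {F : Fml P ar} : F.freeG ⊆ F.occG := by
  induction F with
  | falsum | cmp | pred => exact subset_rfl
  | and F G ihF ihG | or F G ihF ihG | imp F G ihF ihG => exact Finset.union_subset_union ihF ihG
  | allG x F ih | exG x F ih =>
    exact fun y hy => Finset.mem_insert_of_mem (ih (Finset.mem_sdiff.1 hy).1)
  | allI i F ih | exI i F ih => exact ih

namespace Fml

variable {P : Type} {ar : P → ℕ} [LinearOrder Precomputed] {I : Bool → GAtom P ar → Prop}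
  {F : Fml P ar} {ρ : Var → Precomputed} {η : IVar → ℤ} {w : Bool} {xs : List Var}

theorem sat_exList_iff_override : (exList xs F).Sat I ρ η w ↔
    ∃ r : Fin xs.length → Precomputed, F.Sat I (override ρ xs r) η w := by
  rw [sat_exList]
  constructor
  · rintro ⟨ρ', h, hF⟩
    exact ⟨_, (override_get h).symm ▸ hF⟩
  · rintro ⟨r, hF⟩
    exact ⟨_, fun y hy => override_of_notMem hy, hF⟩

theorem sat_allList_iff_override : (allList xs F).Sat I ρ η w ↔
    ∀ r : Fin xs.length → Precomputed, F.Sat I (override ρ xs r) η w := by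
  rw [sat_allList]
  constructor
  · exact fun h r => h _ fun y hy => override_of_notMem hy
  · intro h ρ' h'
    have := h fun k => ρ' (xs.get k)
    rwa [override_get h'] at this

end Fml

section

variable {ρ : Var → Precomputed} {X : List Var} {F : Fml₀} {n : ℕ}

/-- The tuple of values of the copy `Xᵢ` of the tuple `X` of variables. -/
def copyTuple (ρ : Var → Precomputed) (X : List Var) (F : Fml₀) (i : ℕ) :
    Fin X.length → Precomputed := fun k => ρ (copyVar X F i k)

theorem mem_copyVars {y : Var} :
    y ∈ copyVars X F n ↔ ∃ i < n, ∃ k < X.length, copyVar X F i k = y := by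
  simp [copyVars]

theorem copyVar_notMem_occG (i k : ℕ) : copyVar X F i k ∉ F.occG := fun h =>
  absurd (lt_freshFrom (Finset.mem_union_left X.toFinset h)) (Nat.le_add_right _ _).not_gt

theorem exists_assignment_copyVars (ρ : Var → Precomputed) (X : List Var) (F : Fml₀) (n : ℕ)
    (f : ℕ → Fin X.length → Precomputed) :
    ∃ ρ' : Var → Precomputed, (∀ y ∉ copyVars X F n, ρ' y = ρ y) ∧
      ∀ i < n, ∀ k : Fin X.length, ρ' (copyVar X F i k) = f i k := by
  refine ⟨fun y => if h : y ∈ copyVars X F n then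
    f ((y - freshFrom (F.occG ∪ X.toFinset)) / X.length)
      ⟨(y - freshFrom (F.occG ∪ X.toFinset)) % X.length, Nat.mod_lt _ ?_⟩ else ρ y,
    fun y hy => dif_neg hy, fun i hi k => ?_⟩
  · obtain ⟨_, _, k, hk, _⟩ := mem_copyVars.1 h
    exact k.zero_le.trans_lt hk
  · have hk : 0 < X.length := k.1.zero_le.trans_lt k.2
    have hmem : copyVar X F i k ∈ copyVars X F n := mem_copyVars.2 ⟨i, hi, k, k.2, rfl⟩
    have hsub : copyVar X F i k - freshFrom (F.occG ∪ X.toFinset) = i * X.length + k :=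
      Nat.add_sub_cancel_left ..
    have hdiv : (i * X.length + k) / X.length = i := by
      rw [Nat.add_comm, Nat.add_mul_div_right _ _ hk, Nat.div_eq_of_lt k.2, Nat.zero_add]
    have hmod : (i * X.length + k) % X.length = k := by
      rw [Nat.mul_add_mod_self_right, Nat.mod_eq_of_lt k.2]
    simp only [dif_pos hmem, hsub, hdiv, hmod]

theorem mem_pairsBelow {p : ℕ × ℕ} : p ∈ pairsBelow n ↔ p.1 < p.2 ∧ p.2 < n := by
  rcases p with ⟨i, j⟩
  simp [pairsBelow, and_comm]

/-- There are `n` distinct elements with the property `Q` iff there is a finite set of at least `n`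
elements with this property. -/
theorem exists_distinct_iff {α : Type} [Nonempty α] {Q : α → Prop} {n : ℕ} :
    (∃ f : ℕ → α, (∀ i < n, Q (f i)) ∧ ∀ i j, i < j → j < n → f i ≠ f j) ↔
      ∃ Δ : Finset α, n ≤ Δ.card ∧ ∀ x ∈ Δ, Q x := by
  constructor
  · rintro ⟨f, hQ, hf⟩
    refine ⟨(Finset.range n).image f, ?_, ?_⟩
    · rw [Finset.card_image_of_injOn, Finset.card_range]
      intro i hi j hj hij
      simp only [Finset.coe_range, Set.mem_Iio] at hi hj
      rcases lt_trichotomy i j with h | h | h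
      exacts [absurd hij (hf i j h hj), h, absurd hij.symm (hf j i h hi)]
    · simpa using hQ
  · rintro ⟨Δ, hn, hQ⟩
    let e := Δ.equivFin.symm
    refine ⟨fun i => if h : i < Δ.card then (e ⟨i, h⟩).1 else Classical.arbitrary α,
      fun i hi => ?_, fun i j hij hj => ?_⟩
    · simp only [dif_pos (hi.trans_le hn)]
      exact hQ _ (e _).2
    · simp only [dif_pos (hj.trans_le hn), dif_pos (hij.trans (hj.trans_le hn))]
      intro h
      have := e.injective (Subtype.ext h)
      simp only [Fin.mk.injEq] at this
      exact hij.ne this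

theorem exists_copies_iff {Q : (Fin X.length → Precomputed) → Prop} :
    (∃ ρ' : Var → Precomputed, (∀ y ∉ copyVars X F n, ρ' y = ρ y) ∧
      (∀ i < n, Q (copyTuple ρ' X F i)) ∧
        ∀ i j, i < j → j < n → copyTuple ρ' X F i ≠
          copyTuple ρ' X F j) ↔
      ∃ Δ : Finset (Fin X.length → Precomputed), n ≤ Δ.card ∧ ∀ x ∈ Δ, Q x := by
  have : Nonempty (Fin X.length → Precomputed) := ⟨fun _ => .inf⟩
  rw [← exists_distinct_iff]
  constructor
  · rintro ⟨ρ', -, hQ, h⟩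
    exact ⟨copyTuple ρ' X F, hQ, h⟩
  · rintro ⟨f, hQ, h⟩
    obtain ⟨ρ', h1, h2⟩ := exists_assignment_copyVars ρ X F n f
    refine ⟨ρ', h1, fun i hi => ?_, fun i j hij hj => ?_⟩
    · rw [show copyTuple ρ' X F i = f i from funext (h2 i hi)]; exact hQ i hi
    · rw [show copyTuple ρ' X F i = f i from funext (h2 i (hij.trans hj)),
        show copyTuple ρ' X F j = f j from funext (h2 j hj)]
      exact h i j hij hj

end

section

variable [LinearOrder Precomputed] {I : Bool → PreAtom → Prop}
  {ρ ρ' : Var → Precomputed} {η : IVar → ℤ} {w : Bool} {X : List Var} {F : Fml₀} {n : ℕ}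

/-- In the formula `F(Xᵢ)` the values of the fresh variables play the role of values of `X`. -/
theorem sat_copyFml (h : ∀ y ∉ copyVars X F n, ρ' y = ρ y) (i : ℕ) :
    (copyFml X F i).Sat I ρ' η w ↔
      F.Sat I (override ρ X (copyTuple ρ' X F i)) η w := by
  rw [copyFml, Fml.sat_subst]
  · refine Fml.sat_congr (fun x hx => ?_) fun _ _ => rfl
    by_cases hX : x ∈ X
    · simp [hX, override, assign_of_mem hX, GTerm.eval, copyTuple]
    · rw [override_of_notMem hX, if_neg hX]
      refine h x fun hx' => ?_
      obtain ⟨i, -, k, -, rfl⟩ := mem_copyVars.1 hx'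
      exact copyVar_notMem_occG i k (Fml.freeG_subset_occG hx)
  · intro x y hy
    split_ifs at hy
    · obtain rfl : y = _ := by simpa [GTerm.varsG] using hy
      exact Or.inr (copyVar_notMem_occG _ _)
    · exact Or.inl (by simpa [GTerm.varsG] using hy)
  · intro x
    split_ifs <;> rfl
  · simp [ITerm.vars]

theorem sat_copyEq {i j : ℕ} : (copyEq X F i j).Sat I ρ η w ↔
    copyTuple ρ X F i = copyTuple ρ X F j := by
  simp only [copyEq, Fml.sat_conjList, List.mem_map, List.mem_range, forall_exists_index, and_imp,
    forall_apply_eq_imp_iff₂, Fml.Sat, CmpOp.Holds, GTerm.eval, copyTuple,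
    funext_iff]
  exact ⟨fun h k => h k k.2, fun h k hk => h ⟨k, hk⟩⟩

theorem sat_atleastN : (atleastN n X F).Sat I ρ η w ↔
    ∃ Δ : Finset (Fin X.length → Precomputed),
      n ≤ Δ.card ∧ ∀ x ∈ Δ, F.Sat I (override ρ X x) η w := by
  rw [← exists_copies_iff (F := F) (ρ := ρ), atleastN, Fml.sat_exList]
  refine exists_congr fun ρ' => and_congr_right fun h => ?_
  simp only [Fml.Sat, Fml.sat_conjList, List.mem_map, List.mem_range, forall_exists_index,
    and_imp, forall_apply_eq_imp_iff₂, sat_copyFml h, mem_pairsBelow, Prod.forall]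
  refine and_congr_right fun _ => ⟨fun H i j hij hj he => ?_, ?_⟩
  · exact Fml.sat_neg.1 (H _ i j hij hj rfl) w le_rfl (sat_copyEq.2 he)
  · rintro H _ i j hij hj rfl
    exact Fml.sat_neg.2 fun v _ h => H i j hij hj (sat_copyEq.1 h)

theorem sat_atmostN : (atmostN n X F).Sat I ρ η w ↔
    ∀ v, w ≤ v → ∀ Δ : Finset (Fin X.length → Precomputed),
      n < Δ.card → ¬ ∀ x ∈ Δ, F.Sat I (override ρ X x) η v := by
  have key (v : Bool) := not_congr (exists_copies_iff (F := F) (ρ := ρ) (n := n + 1)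
    (Q := fun x => F.Sat I (override ρ X x) η v))
  push Not at key
  rw [atmostN, Fml.sat_allList]
  calc _ ↔ ∀ v, w ≤ v → ∀ ρ' : Var → Precomputed, (∀ y ∉ copyVars X F (n + 1), ρ' y = ρ y) →
        (∀ i < n + 1, F.Sat I (override ρ X (copyTuple ρ' X F i)) η v) →
        ∃ i j, i < j ∧ j < n + 1 ∧ copyTuple ρ' X F i =
          copyTuple ρ' X F j := by
        have (ρ' : Var → Precomputed) (h : ∀ y ∉ copyVars X F (n + 1), ρ' y = ρ y) :=
          fun v i => sat_copyFml (I := I) (η := η) (w := v) h i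
        simp only [Fml.Sat, Fml.sat_conjList, Fml.sat_disjList, List.mem_map, List.mem_range,
          forall_exists_index, and_imp, forall_apply_eq_imp_iff₂]
        constructor
        · intro H v hv ρ' h hF
          obtain ⟨_, ⟨⟨i, j⟩, hij, rfl⟩, he⟩ := H ρ' h v hv fun i hi => (this ρ' h v i).2 (hF i hi)
          exact ⟨i, j, (mem_pairsBelow.1 hij).1, (mem_pairsBelow.1 hij).2, sat_copyEq.1 he⟩
        · intro H ρ' h v hv hF
          obtain ⟨i, j, hij, hj, he⟩ := H v hv ρ' h fun i hi => (this ρ' h v i).1 (hF i hi)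
          exact ⟨_, ⟨(i, j), mem_pairsBelow.2 ⟨hij, hj⟩, rfl⟩, sat_copyEq.2 he⟩
    _ ↔ _ := by
        refine forall_congr' fun v => imp_congr_right fun _ => ?_
        push Not
        exact key v

theorem AdmissibleOrder.eq_num (hord : AdmissibleOrder) {r : Precomputed} {m : ℤ}
    (h : Precomputed.num 0 ≤ r) (h' : r ≤ .num m) : ∃ k : ℕ, r = .num k := by
  obtain ⟨k, rfl⟩ := hord.contiguous _ _ _ h h'
  exact ⟨k.toNat, by rw [Int.toNat_of_nonneg ((hord.num_le_num _ _).1 h)]⟩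

theorem sat_existsGE (hord : AdmissibleOrder) {r : Precomputed} :
    (existsGE r X F).Sat I ρ η w ↔ ∃ Δ : Finset (Fin X.length → Precomputed),
      Precomputed.num Δ.card ≥ r ∧ ∀ x ∈ Δ, F.Sat I (override ρ X x) η w := by
  unfold existsGE
  split_ifs with h
  -- If `r ≤ 0` then the empty set can be taken as `Δ`.
  · simpa using ⟨∅, by simpa using h, by simp⟩
  · rw [not_le] at h
    have hr (hr : ∀ k : ℕ, r ≠ .num k) : ∀ Δ : Finset (Fin X.length → Precomputed),
        ¬ Precomputed.num Δ.card ≥ r := fun Δ hΔ =>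
      let ⟨k, hk⟩ := hord.eq_num h.le hΔ
      hr k hk
    cases r with
    | num n => simp only [sat_atleastN, Int.toNat_le, ge_iff_le, hord.num_le_num]
    | sym c | inf | sup => simpa [Fml.Sat] using fun Δ h => absurd h (hr (by simp) Δ)

theorem sat_existsLE (hord : AdmissibleOrder) {r : Precomputed} :
    (existsLE r X F).Sat I ρ η w ↔ ∀ v, w ≤ v → ∀ Δ : Finset (Fin X.length → Precomputed),
      Precomputed.num Δ.card > r → ¬ ∀ x ∈ Δ, F.Sat I (override ρ X x) η v := by
  unfold existsLE
  split_ifs with h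
  -- If `r < 0` then the empty set is a counterexample.
  · simp only [Fml.Sat, false_iff]
    exact fun H => H w le_rfl ∅ (by simpa using h) (by simp)
  · rw [not_lt] at h
    have hr (hr : ∀ k : ℕ, r ≠ .num k) : ∀ Δ : Finset (Fin X.length → Precomputed),
        ¬ Precomputed.num Δ.card > r := fun Δ hΔ =>
      let ⟨k, hk⟩ := hord.eq_num h hΔ.le
      hr k hk
    cases r with
    | num n =>
      have h0 : 0 ≤ n := (hord.num_le_num _ _).1 h
      have (m : ℕ) : Precomputed.num n < .num m ↔ n.toNat < m := by
        rw [← not_le, hord.num_le_num]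
        omega
      simp only [sat_atmostN, gt_iff_lt, this]
    | sym c | inf | sup =>
      simp only [Fml.sat_top, true_iff]
      exact fun v _ Δ h => absurd h (hr (by simp) Δ)

end

/-! ### The meaning of the defined predicate constants -/

section

variable [LinearOrder Precomputed] {I : Bool → ExtAtom → Prop}
  {ρ : Var → Precomputed} {η : IVar → ℤ} {w : Bool}

/-- The truth value of `Atleast(V, c)` or `Atmost(V, c)` depends only on the values of the members
of `V` and of `c`. -/
theorem sat_pred_snoc_congr (s : CountIndex) (p : Pred₁) (hp : p.arity = s.V.length + 1)
    {ρ' : Var → Precomputed} {η' : IVar → ℤ} {c c' : GTerm} (h : ∀ x ∈ s.V, ρ x = ρ' x)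
    (hc : c.eval ρ η = c'.eval ρ' η') :
    (Fml.pred p fun i => Fin.snoc (α := fun _ => GTerm) (fun i => .var (s.V.get i)) c
        (i.cast hp) : Fml₁).Sat I ρ η w ↔
      (Fml.pred p fun i => Fin.snoc (α := fun _ => GTerm) (fun i => .var (s.V.get i)) c'
        (i.cast hp) : Fml₁).Sat I ρ' η' w := by
  have (j : Fin (s.V.length + 1)) :
      (Fin.snoc (α := fun _ => GTerm) (fun i => .var (s.V.get i)) c j : GTerm).eval ρ η =
      (Fin.snoc (α := fun _ => GTerm) (fun i => .var (s.V.get i)) c' j : GTerm).eval ρ' η' := by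
    induction j using Fin.lastCases with
    | last => simpa using hc
    | cast j => simpa [GTerm.eval] using h _ (List.get_mem _ _)
  simp only [Fml.Sat, this]

/-- The assignment that agrees with `ρ` on the members of `s.V` and has the value used by `gr` for
free variables everywhere else. -/
def restrict (s : CountIndex) (ρ : Var → Precomputed) : Var → Precomputed :=
  fun y => if y ∈ s.V then ρ y else .inf

theorem sat_override_restrict {I : Bool → PreAtom → Prop} (s : CountIndex)
    {x : Fin s.X.length → Precomputed} {η' : IVar → ℤ} :
    s.F.Sat I (override (restrict s ρ) s.X x) η' w ↔ s.F.Sat I (override ρ s.X x) η w := by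
  refine Fml.sat_congr (fun y hy => ?_) (by simp [s.freeI])
  by_cases hX : y ∈ s.X
  · exact override_congr_of_mem hX
  · rw [override_of_notMem hX, override_of_notMem hX, restrict,
      if_pos ((s.freeG y hy).resolve_left hX)]

/-- The definitions determine the meaning of `Atleast` at all worlds where they hold. They are closed
by universal quantifiers over `V` only, which is why `ρ` is first restricted to `V`. -/
theorem sat_atleast (hord : AdmissibleOrder) (hD : ∀ G ∈ grDefs, G.Sat I w) (s : CountIndex)
    (c : GTerm) : (Fml.atleast s c).Sat I ρ η w ↔
      ∃ Δ : Finset (Fin s.X.length → Precomputed), Precomputed.num Δ.card ≥ c.eval ρ η ∧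
        ∀ x ∈ Δ, s.F.Sat (fun w a => I w (PreAtom.toExt a)) (override ρ s.X x) η w := by
  have h := Fml.sat_gr.1 (hD _ ⟨_, ⟨s, c.eval ρ η, Or.inl rfl⟩, rfl⟩)
  have h := Fml.sat_iff.1 (Fml.sat_allList.1 h (restrict s ρ) fun y hy => if_neg hy) w le_rfl
  rw [Fml.sat_lift, sat_existsGE hord] at h
  simp only [sat_override_restrict (η := η)] at h
  rw [← h]
  exact sat_pred_snoc_congr s (.atleast s) rfl (fun x hx => (if_pos hx).symm) (by simp)

theorem sat_atmost (hord : AdmissibleOrder) (hD : ∀ G ∈ grDefs, G.Sat I w) (s : CountIndex)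
    (c : GTerm) : (Fml.atmost s c).Sat I ρ η w ↔
      ∀ v, w ≤ v → ∀ Δ : Finset (Fin s.X.length → Precomputed),
        Precomputed.num Δ.card > c.eval ρ η →
          ¬ ∀ x ∈ Δ, s.F.Sat (fun w a => I w (PreAtom.toExt a)) (override ρ s.X x) η v := by
  have h := Fml.sat_gr.1 (hD _ ⟨_, ⟨s, c.eval ρ η, Or.inr rfl⟩, rfl⟩)
  have h := Fml.sat_iff.1 (Fml.sat_allList.1 h (restrict s ρ) fun y hy => if_neg hy) w le_rfl
  rw [Fml.sat_lift, sat_existsLE hord] at h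
  simp only [sat_override_restrict (η := η)] at h
  rw [← h]
  exact sat_pred_snoc_congr s (.atmost s) rfl (fun x hx => (if_pos hx).symm) (by simp)

end

/-! ### Members of rule bodies -/

section

variable [LinearOrder Precomputed]

/-- The formula `∃ W τᴮ(L)` in the index of the predicate constant that represents an aggregate
element, with `x` as the value of `X`, has the same meaning as the disjunction in the propositional
translation of its ground instance. -/
theorem sat_countIndex (hord : AdmissibleOrder) {I : Bool → PreAtom → Prop}
    {ρ : Var → Precomputed} {η : IVar → ℤ} {w : Bool} {G : Finset Var} {X : List Var}
    {L : List BasicElem} (hX : X.Nodup) (hG : ∀ x ∈ X, x ∉ G) {σ : Assignment}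
    (hσ : ∀ x ∈ G, σ x = some (ρ x)) (hσ' : ∀ x ∉ G, σ x = none)
    (x : Fin X.length → Precomputed) :
    (countIndex G X L hX hG).F.Sat I (override ρ X x) η w ↔
      ∃ u : Fin (otherVars X (L.map (BasicElem.subst σ))).length → Precomputed,
        (InfForm.conjList ((L.map (BasicElem.subst σ)).map fun b =>
          (b.subst fun y => (assign X x y).or
            (assign (otherVars X (L.map (BasicElem.subst σ))) u y)).tau)).Sat I w := by
  have hW : otherVars X (L.map (BasicElem.subst σ)) =
      ((basicVars L \ G) \ X.toFinset).sort (· ≤ ·) := by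
    rw [otherVars]
    congr 1
    ext y
    have : σ y = none ↔ y ∉ G := ⟨fun h hy => by simp [hσ y hy] at h, hσ' y⟩
    simp only [Finset.mem_sdiff, mem_basicVars_subst, this]
  have hmem (y : Var) : y ∈ otherVars X (L.map (BasicElem.subst σ)) ↔
      (y ∈ basicVars L ∧ y ∉ G) ∧ y ∉ X := by
    simp [hW]
  have hF : (countIndex G X L hX hG).F =
      .exList (otherVars X (L.map (BasicElem.subst σ))) (tauBConj L) := by
    rw [hW]
    rfl
  rw [hF, Fml.sat_exList_iff_override]
  refine exists_congr fun u => ?_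
  rw [tauBConj, Fml.sat_conjList, InfForm.sat_conjList]
  simp only [List.mem_map, forall_exists_index, and_imp, forall_apply_eq_imp_iff₂,
    BasicElem.subst_subst]
  refine forall₂_congr fun b hb => sat_tauB hord fun y hy => ?_
  have hyL : y ∈ basicVars L := mem_basicVars.2 ⟨b, hb, hy⟩
  by_cases hyG : y ∈ G
  · have hyX : y ∉ X := fun h => hG y h hyG
    rw [hσ y hyG, override_of_notMem (by simp [hmem, hyG]), override_of_notMem hyX]
    rfl
  · by_cases hyX : y ∈ X
    · rw [hσ' y hyG, override_of_notMem (by simp [hmem, hyX]), override_of_mem (ρ := ρ) hyX]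
      rfl
    · have hyW := (hmem y).2 ⟨⟨hyL, hyG⟩, hyX⟩
      rw [hσ' y hyG, assign_of_notMem hyX, override_of_mem hyW]
      rfl

/-- The formula `B*` has the same meaning as the propositional translation of the ground instance of
`B`. For aggregate atoms, interval-freeness guarantees that the bound has at most one value, so that
the case distinction in the propositional translation covers everything. -/
theorem sat_star (hord : AdmissibleOrder) {I : Bool → ExtAtom → Prop}
    {ρ : Var → Precomputed} {η : IVar → ℤ} {w : Bool}
    (hD : ∀ G ∈ grDefs, G.Sat I w) {G : Finset Var} {B : BodyElem} (hB : B.Translatable G)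
    (hBG : B.outerVars ⊆ G) (hint : ∀ X L rel t, B = .count X L rel t → t.IntervalFree)
    {σ : Assignment} (hσ : ∀ x ∈ G, σ x = some (ρ x)) (hσ' : ∀ x ∉ G, σ x = none) :
    (B.star G hB).Sat I ρ η w ↔
      (B.subst σ).tau.Sat (fun w a => I w (PreAtom.toExt a)) w := by
  cases B with
  | basic b =>
    simp only [BodyElem.star, Fml.sat_lift]
    exact sat_tauB hord fun x hx => hσ x (hBG hx)
  | count X L rel t =>
    set C := freshFrom (basicVars L ∪ G ∪ t.vars) with hC
    have hne (r : Precomputed) (x : Var) (hx : x ∈ basicVars L ∪ G ∪ t.vars) :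
        Function.update ρ C r x = ρ x := Function.update_of_ne (lt_freshFrom hx).ne _ _
    have hσC (r : Precomputed) (x : Var) (hx : x ∈ G) : σ x = some (Function.update ρ C r x) := by
      rw [hσ x hx, hne r x (by simp [hx])]
    have hval (r : Precomputed) : (val t (.var C) 0 : Fml₁).Sat I (Function.update ρ C r) η w ↔
        r ∈ (t.subst σ).values := by
      rw [sat_val hord (by simp [GTerm.varsI]),
        Term.subst_congr (σ := closing (Function.update ρ C r)) (σ' := σ) fun x hx =>
          (hσC r x (hBG hx)).symm]
      simp [GTerm.eval]
    have hsub := Term.subsingleton_values (hint X L rel t rfl) σ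
    have htau (Δ : Finset (Fin X.length → Precomputed)) (r : Precomputed) (v : Bool) :
        (tauDelta X (L.map (BasicElem.subst σ)) Δ).Sat (fun w a => I w (PreAtom.toExt a)) v ↔
          ∀ x ∈ Δ, (countIndex G X L hB.1 hB.2).F.Sat (fun w a => I w (PreAtom.toExt a))
            (override (Function.update ρ C r) X x) η v := by
      simp only [tauDelta, InfForm.Sat, Subtype.forall]
      exact forall₂_congr fun x _ => (sat_countIndex hord hB.1 hB.2 (hσC r) hσ' x).symm
    have heval (r : Precomputed) : (GTerm.var C).eval (Function.update ρ C r) η = r := by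
      simp [GTerm.eval]
    cases rel with
    | ge =>
      simp only [BodyElem.star, ← hC, Fml.Sat, hval, sat_atleast hord hD, heval, BodyElem.subst,
        BodyElem.tau]
      split_ifs with h
      · simp only [InfForm.Sat, Subtype.exists, exists_prop]
        have hc : h.choose ∈ (t.subst σ).values := (Set.ext_iff.1 h.choose_spec _).2 rfl
        constructor
        · rintro ⟨r, hr, Δ, h1, h2⟩
          exact ⟨Δ, hsub hc hr ▸ h1, (htau Δ r w).2 h2⟩
        · rintro ⟨Δ, h1, h2⟩
          exact ⟨_, hc, Δ, h1, (htau Δ _ w).1 h2⟩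
      · simp only [InfForm.not_sat_bot, iff_false]
        rintro ⟨r, hr, -⟩
        exact h ⟨r, hsub.eq_singleton_of_mem hr⟩
    | le =>
      simp only [BodyElem.star, ← hC, Fml.Sat, hval, sat_atmost hord hD, heval, BodyElem.subst,
        BodyElem.tau]
      split_ifs with h
      · simp only [InfForm.Sat, Subtype.forall, InfForm.sat_neg]
        have hc : h.choose ∈ (t.subst σ).values := (Set.ext_iff.1 h.choose_spec _).2 rfl
        constructor
        · rintro ⟨r, hr, H⟩ Δ h1 v hv h2
          exact H v hv Δ (hsub hc hr ▸ h1) ((htau Δ r v).1 h2)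
        · exact fun H => ⟨_, hc, fun v hv Δ h1 h2 => H Δ h1 v hv ((htau Δ _ v).2 h2)⟩
      · simp only [InfForm.not_sat_bot, iff_false]
        rintro ⟨r, hr, -⟩
        exact h ⟨r, hsub.eq_singleton_of_mem hr⟩

end

/-! ### Finite rank of the propositional translation -/

namespace InfForm

variable {A B : Type}

theorem DepthLE.map {f : A → B} {F : InfForm A} {n : ℕ} (h : F.DepthLE n) :
    (F.map f).DepthLE n := by
  induction F generalizing n with
  | atom a => trivial
  | conj ι F ih | disj ι F ih =>
    obtain ⟨m, hm, h⟩ := h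
    exact ⟨m, hm, fun i => ih i (h i)⟩
  | imp F G ihF ihG =>
    obtain ⟨m, hm, hF, hG⟩ := h
    exact ⟨m, hm, ihF hF, ihG hG⟩

theorem depthLE_top {n : ℕ} (hn : 0 < n) : (top : InfForm A).DepthLE n := ⟨0, hn, fun i => i.elim⟩

theorem depthLE_bot {n : ℕ} (hn : 0 < n) : (bot : InfForm A).DepthLE n := ⟨0, hn, fun i => i.elim⟩

theorem DepthLE.neg {F : InfForm A} {n : ℕ} (h : F.DepthLE n) : F.neg.DepthLE (n + 2) :=
  ⟨n + 1, by omega, h.mono (by omega), depthLE_bot (by omega)⟩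

theorem depthLE_conjList {Fs : List (InfForm A)} {n : ℕ} (h : ∀ F ∈ Fs, F.DepthLE n) :
    (conjList Fs).DepthLE (n + Fs.length + 1) := by
  induction Fs with
  | nil => exact depthLE_top (by simp)
  | cons F Fs ih =>
    refine ⟨n + Fs.length + 1, by simp, ?_⟩
    rintro (_ | _)
    · exact ih fun F hF => h F (List.mem_cons_of_mem _ hF)
    · exact (h F List.mem_cons_self).mono (by omega)

end InfForm

section

open InfForm

variable [LinearOrder Precomputed]

theorem BasicElem.depthLE_tau (b : BasicElem) : b.tau.DepthLE 5 := by
  cases b with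
  | lit s a =>
    have h (r) : (a.inst r).DepthLE 0 := trivial
    cases s with
    | pos => exact ⟨4, by decide, fun r => (h r).mono (by decide)⟩
    | neg => exact ⟨4, by decide, fun r => (h r).neg.mono (by decide)⟩
    | negneg => exact ⟨4, by decide, fun r => (h r).neg.neg⟩
  | cmp op t₁ t₂ =>
    simp only [BasicElem.tau]
    split_ifs
    exacts [depthLE_top (by decide), depthLE_bot (by decide)]

theorem BodyElem.exists_depthLE_tau (B : BodyElem) : ∃ n, ∀ σ, (B.subst σ).tau.DepthLE n := by
  cases B with
  | basic b => exact ⟨5, fun σ => BasicElem.depthLE_tau _⟩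
  | count X L rel t =>
    have hD (σ) (Δ) : (tauDelta X (L.map (BasicElem.subst σ)) Δ).DepthLE (L.length + 8) := by
      refine ⟨L.length + 7, by omega, fun x => ⟨L.length + 6, by omega, fun u => ?_⟩⟩
      refine (depthLE_conjList (n := 5) fun F hF => ?_).mono (by simp; omega)
      obtain ⟨b, -, rfl⟩ := List.mem_map.1 hF
      exact BasicElem.depthLE_tau _
    refine ⟨L.length + 11, fun σ => ?_⟩
    cases rel <;> simp only [BodyElem.subst, BodyElem.tau] <;> split_ifs
    · exact ⟨L.length + 8, by omega, fun Δ => hD σ _⟩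
    · exact depthLE_bot (by omega)
    · exact ⟨L.length + 10, by omega, fun Δ => (hD σ _).neg⟩
    · exact depthLE_bot (by omega)

theorem Rule.finiteRank_tau (R : Rule) : R.tau.FiniteRank := by
  have hbody : ∃ n, ∀ σ, ∀ B ∈ R.body, (B.subst σ).tau.DepthLE n := by
    induction R.body with
    | nil => exact ⟨0, by simp⟩
    | cons B Bs ih =>
      obtain ⟨m, hm⟩ := B.exists_depthLE_tau
      obtain ⟨n, hn⟩ := ih
      refine ⟨max m n, fun σ B' hB' => ?_⟩
      rcases List.mem_cons.1 hB' with rfl | hB'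
      · exact (hm σ).mono (le_max_left _ _)
      · exact (hn σ B' hB').mono (le_max_right _ _)
  obtain ⟨n, hn⟩ := hbody
  refine finiteRank_conj_iff.2 ⟨n + R.body.length + 6, fun v => ?_⟩
  generalize assign R.globalList v = σ
  have hb : (conjList ((R.subst σ).body.map BodyElem.tau)).DepthLE (n + R.body.length + 1) := by
    refine (depthLE_conjList (n := n) fun F hF => ?_).mono (by simp [Rule.subst])
    simp only [Rule.subst, List.map_map, List.mem_map] at hF
    obtain ⟨B, hB, rfl⟩ := hF
    exact hn σ B hB
  have ha (a : Atom) (r) : (a.inst r).DepthLE 0 := trivial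
  rcases R with ⟨_ | _ | _, body⟩
  · exact ⟨_, Nat.lt_succ_self _, hb.mono (by simp), 0, by simp, fun r => ha _ _⟩
  · refine ⟨_, Nat.lt_succ_self _, hb.mono (by simp), 4, by simp, fun r => ⟨3, by decide, ?_⟩⟩
    rintro (_ | _)
    · exact (ha _ _).neg.mono (by decide)
    · exact (ha _ _).mono (by decide)
  · exact hb.neg.mono (by simp)

end

/-! ### Rules -/

theorem Rule.outerVars_subset_globals {R : Rule} {B : BodyElem} (hB : B ∈ R.body) :
    B.outerVars ⊆ R.globals := by
  rcases R with ⟨head, body⟩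
  refine Finset.Subset.trans (?_ : _ ⊆ body.foldr (fun B S => BodyElem.outerVars B ∪ S) ∅)
    Finset.subset_union_right
  change B ∈ body at hB
  induction body with
  | nil => simp at hB
  | cons B' Bs ih =>
    rcases List.mem_cons.1 hB with rfl | hB
    · exact Finset.subset_union_left
    · exact (ih hB).trans Finset.subset_union_right

theorem Rule.globals_subset_vars (R : Rule) : R.globals ⊆ R.vars := by
  refine Finset.union_subset_union_right ?_
  induction R.body with
  | nil => exact subset_rfl
  | cons B Bs ih =>
    refine Finset.union_subset_union ?_ ih
    cases B with
    | basic b => exact subset_rfl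
    | count X L rel t => exact Finset.subset_union_right

section

variable [LinearOrder Precomputed]

theorem sat_body_star (hord : AdmissibleOrder) {I : Bool → ExtAtom → Prop}
    {ρ : Var → Precomputed} {η : IVar → ℤ} {w : Bool}
    (hD : ∀ G ∈ grDefs, G.Sat I w) {R : Rule} (hR : R.WellFormed) (hP : R.Pure) {σ : Assignment}
    (hσ : ∀ x ∈ R.globals, σ x = some (ρ x)) (hσ' : ∀ x ∉ R.globals, σ x = none) :
    (Fml.conjList (R.body.pmap (BodyElem.star R.globals) (Rule.translatable hR hP))).Sat I ρ η w ↔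
      (InfForm.conjList ((R.subst σ).body.map BodyElem.tau)).Sat
        (fun w a => I w (PreAtom.toExt a)) w := by
  simp only [Fml.sat_conjList, InfForm.sat_conjList, Rule.subst, List.map_map, List.mem_map,
    List.mem_pmap, forall_exists_index, and_imp]
  have key (B : BodyElem) (hB : B ∈ R.body) := sat_star hord (η := η) hD
    (Rule.translatable hR hP B hB) (Rule.outerVars_subset_globals hB)
    (fun X L rel t h => (hR X L rel t (h ▸ hB)).2.2) hσ hσ'
  constructor
  · rintro H _ B hB rfl
    exact (key B hB).1 (H _ B hB rfl)
  · rintro H _ B hB rfl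
    exact (key B hB).2 (H _ B hB rfl)

/-- In every model of the definitions of the predicate constants `Atleast` and `Atmost`, the two
translations of a pure rule have the same meaning. -/
theorem sat_tauStar (hord : AdmissibleOrder) {I : Bool → ExtAtom → Prop}
    (hI : ∀ a, I false a → I true a) {w : Bool} (hD : ∀ G ∈ grDefs, G.Sat I w) {R : Rule}
    (hR : R.WellFormed) (hP : R.Pure) :
    (R.tauStar hR hP).Sat I (fun _ => .inf) (fun _ => 0) w ↔
      R.tau.Sat (fun w a => I w (PreAtom.toExt a)) w := by
  have hmem (x : Var) : x ∈ R.globalList ↔ x ∈ R.globals := by simp [Rule.globalList]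
  have hDv (v : Bool) (hv : w ≤ v) : ∀ G ∈ grDefs, G.Sat I v := fun G hG => (hD G hG).mono hI hv
  have hbody (u : Fin R.globalList.length → Precomputed) (ρ : Var → Precomputed)
      (hρ : ∀ x ∈ R.globals, ρ x = override (fun _ => .inf) R.globalList u x) (v : Bool)
      (hv : w ≤ v) := sat_body_star hord (η := fun _ => 0) (ρ := ρ) (hDv v hv) hR hP
        (σ := assign R.globalList u)
        (fun x hx => by rw [hρ x hx, override_of_mem ((hmem x).2 hx)])
        (fun x hx => assign_of_notMem fun h => hx ((hmem x).1 h))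
  have hfresh (n : ℕ) (x : Var) (hx : x ∈ R.globals) : x ∉ varTuple (freshFrom R.vars) n := by
    rw [mem_varTuple]
    rintro ⟨i, -, rfl⟩
    exact absurd (lt_freshFrom (R.globals_subset_vars hx)) (Nat.le_add_right _ _).not_gt
  have happ (xs ys : List Var) (F : Fml₁) :
      Fml.allList (xs ++ ys) F = Fml.allList xs (Fml.allList ys F) := List.foldr_append
  have hpred (a : Atom) (z : Var) (ρ : Var → Precomputed) (v : Bool) :
      (predArgs a z).lift.Sat I ρ (fun _ => 0) v ↔
        I v (PreAtom.toExt ⟨⟨a.name, a.arity⟩, fun i => ρ (z + i)⟩) := Iff.rfl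
  have hinst (a : Atom) (u) (v : Bool) (r) :
      ((a.subst (assign R.globalList u)).inst r).Sat (fun w a => I w (PreAtom.toExt a)) v ↔
        I v (PreAtom.toExt ⟨⟨a.name, a.arity⟩, r⟩) := Iff.rfl
  have hhead (a : Atom) (ha : a.vars ⊆ R.globals) (u : Fin R.globalList.length → Precomputed)
      (Q : Bool → (Fin a.arity → Precomputed) → Prop) :
      (∀ ρ : Var → Precomputed, (∀ y ∉ varTuple (freshFrom R.vars) a.arity,
          ρ y = override (fun _ => .inf) R.globalList u y) → ∀ v, w ≤ v →
        (Fml.conjList (R.body.pmap (BodyElem.star R.globals)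
          (Rule.translatable hR hP))).Sat I ρ (fun _ => 0) v ∧
          (valArgs a (freshFrom R.vars) : Fml₁).Sat I ρ (fun _ => 0) v →
        Q v fun i => ρ (freshFrom R.vars + i)) ↔
      ∀ v, w ≤ v →
        (InfForm.conjList ((R.subst (assign R.globalList u)).body.map BodyElem.tau)).Sat
          (fun w a => I w (PreAtom.toExt a)) v →
        ∀ r : (a.subst (assign R.globalList u)).Values, Q v r.1 := by
    have key := forall_values_iff (ρ := override (fun _ => .inf) R.globalList u) (a := a)
      (z := freshFrom R.vars)
      (fun x hx => lt_freshFrom (R.globals_subset_vars (ha hx)))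
      (σ := assign R.globalList u) (fun x hx => override_of_mem ((hmem x).2 (ha hx)))
    constructor
    · intro H v hv hb
      exact (key (Q v)).2 fun ρ hρ hval => H ρ hρ v hv
        ⟨(hbody u ρ (fun x hx => hρ x (hfresh _ x hx)) v hv).2 hb, (sat_valArgs hord).2 hval⟩
    · rintro H ρ hρ v hv ⟨hb, hval⟩
      exact (key (Q v)).1 (H v hv ((hbody u ρ (fun x hx => hρ x (hfresh _ x hx)) v hv).1 hb)) ρ hρ
        ((sat_valArgs hord).1 hval)
  rcases R with ⟨a | a | _, body⟩
  · simp only [Rule.tauStar, happ, Fml.sat_allList_iff_override (xs := Rule.globalList _)]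
    refine forall_congr' fun u => ?_
    rw [Fml.sat_allList]
    exact hhead a Finset.subset_union_left u
      fun v r => I v (PreAtom.toExt ⟨⟨a.name, a.arity⟩, r⟩)
  · simp only [Rule.tauStar, happ, Fml.sat_allList_iff_override (xs := Rule.globalList _)]
    refine forall_congr' fun u => ?_
    rw [Fml.sat_allList]
    have := hhead a Finset.subset_union_left u
      fun v r => I v (PreAtom.toExt ⟨⟨a.name, a.arity⟩, r⟩) ∨
        ∀ v', v ≤ v' → ¬ I v' (PreAtom.toExt ⟨⟨a.name, a.arity⟩, r⟩)
    simp only [Fml.Sat, Rule.tauClosed, Rule.subst, Head.subst, InfForm.Sat, InfForm.sat_or,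
      InfForm.sat_neg, Fml.sat_neg, hpred, hinst]
    exact this
  · simp only [Rule.tauStar, Fml.sat_allList_iff_override]
    refine forall_congr' fun u => ?_
    simp only [Rule.tauClosed, Rule.subst, Head.subst, InfForm.sat_neg, Fml.sat_neg]
    exact forall₂_congr fun v hv => not_congr (hbody u _ (fun _ _ => rfl) v hv)

end

end MGC

theorem theorem1 [LinearOrder MGC.Precomputed] (hord : MGC.AdmissibleOrder)
    (R : MGC.Rule) (hR : R.WellFormed) (hP : R.Pure) :
    MGC.HTEquiv MGC.grDefs (MGC.gr (R.tauStar hR hP)) (R.tau.map MGC.PreAtom.toExt) := by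
  have : Nonempty MGC.ExtAtom := ⟨⟨.base ⟨0, 0⟩, Fin.elim0⟩⟩
  have h1 : (MGC.gr (R.tauStar hR hP)).FiniteRank := ⟨_, MGC.Fml.depthLE_gr⟩
  have h2 : (R.tau.map MGC.PreAtom.toExt).FiniteRank :=
    R.finiteRank_tau.imp fun _ h => h.map
  refine MGC.HT.complete ?_ ((MGC.InfForm.finiteRank_imp_iff.2 ⟨h1, h2⟩).and
    (MGC.InfForm.finiteRank_imp_iff.2 ⟨h2, h1⟩)) fun I w hI hD => ?_
  · rintro _ ⟨F, -, rfl⟩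
    exact ⟨_, MGC.Fml.depthLE_gr⟩
  · refine MGC.InfForm.sat_iff.2 fun v hv => ?_
    rw [MGC.Fml.sat_gr, MGC.InfForm.sat_map]
    exact MGC.sat_tauStar hord hI (fun G hG => (hD G hG).mono hI hv) hR hP
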